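/- Let $\mathbb{P}$ be an abelian group without torsion, written multiplicatively, let $\mathbb{Z}\mathbb{P}$ be its integral group ring, let $K$ be the field of fractions of $\mathbb{Z}\mathbb{P}$, and let $\mathcal{F}$ be a field containing $K$ which is isomorphic over $K$ to the field of rational functions in $3$ independent variables with coefficients in $K$. A *seed* (of rank $3$) in $\mathcal{F}$ is a triple $\Sigma=(\mathbf{x},\mathbf{p},B)$, where $\mathbf{x}=(x_1,x_2,x_3)$ is a transcendence basis of $\mathcal{F}$ over $K$ (the $x_i$ are the *cluster variables* of $\Sigma$), $\mathbf{p}=(p_1^\pm,p_2^\pm,p_3^\pm)$ is a $6$-tuple of elements of $\mathbb{P}$, and $B=(b_{ij})$ is a $3\times 3$ integer matrix which is sign-skew-symmetric: for all $i,j$, either $b_{ij}=b_{ji}=0$ or $b_{ij}b_{ji}<0$. A seed $\Sigma'=(\mathbf{x}',\mathbf{p}',B')$ is obtained from $\Sigma$ by a *seed mutation in direction $k$* if - $x'_i=x_i$ for $i\ne k$, and $x_kx'_k=p_k^+\prod_{b_{ik}>0}x_i^{b_{ik}}+p_k^-\prod_{b_{ik}<0}x_i^{-b_{ik}}$; - ${p'}_k^{\pm}=p_k^{\mp}$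 and, for $i\neq k$, ${p'}_i^+/{p'}_i^-=(p_k^+)^{b_{ki}}\,p_i^+/p_i^-$ if $b_{ki}\ge 0$, and ${p'}_i^+/{p'}_i^-=(p_k^-)^{b_{ki}}\,p_i^+/p_i^-$ if $b_{ki}\le 0$; - $b'_{ij}=-b_{ij}$ if $i=k$ or $j=k$, and $b'_{ij}=b_{ij}+\tfrac12\bigl(|b_{ik}|b_{kj}+b_{ik}|b_{kj}|\bigr)$ otherwise. *Mutation equivalence* of seeds is the equivalence relation generated by seed mutations in all directions. The *cluster algebra* $\mathcal{A}(\Sigma_\circ)$ of a seed $\Sigma_\circ$ is the $\mathbb{Z}\mathbb{P}$-subalgebra of $\mathcal{F}$ generated by all cluster variables of all seeds mutation equivalent to $\Sigma_\circ$. A seed is *acyclic* if the directed graph on $\{1,2,3\}$ with an edge $i\to j$ whenever $b_{ij}>0$ has no oriented cycles. **Theorem.** Let $\Sigma_\circ$ be a seed of rank $3$ in $\mathcal{F}$ whose exchange matrix $B$ is skew-symmetrizable, i.e. there are positive numbers $d_1,d_2,d_3$ with $d_ib_{ij}=-d_jb_{ji}$ for all $i,j$. Then the cluster algebra $\mathcal{A}(\Sigma_\circ)$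 is finitely generated as a $\mathbb{Z}\mathbb{P}$-algebra if and only if some seed mutation equivalent to $\Sigma_\circ$ is acyclic. -/

import Mathlib

namespace ClusterAlgebra

universe u v

/-- The integral group ring `ℤP` of the coefficient group `P` (written multiplicatively). -/
abbrev GroundRing (P : Type u) [CommGroup P] : Type u := MonoidAlgebra ℤ P

/-- The field of fractions of `ℤP`. -/
abbrev GroundField (P : Type u) [CommGroup P] : Type u := FractionRing (GroundRing P)

/-- A square integer matrix is sign-skew-symmetric if, for all `i` and `j`, either
`b i j = b j i = 0` or `b i j * b j i < 0`. -/
def IsSignSkewSymmetric {n : ℕ} (B : Matrix (Fin n) (Fin n) ℤ) : Prop :=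
  ∀ i j, (B i j = 0 ∧ B j i = 0) ∨ B i j * B j i < 0

/-- `B` is skew-symmetrizable if `D * B` is skew-symmetric for some diagonal matrix `D` with
positive diagonal entries `d i`. -/
def IsSkewSymmetrizable {n : ℕ} (B : Matrix (Fin n) (Fin n) ℤ) : Prop :=
  ∃ d : Fin n → ℝ, (∀ i, 0 < d i) ∧ ∀ i j, d i * (B i j : ℝ) = -(d j * (B j i : ℝ))

/-- Matrix mutation in direction `k`. The integer `|b i k| * b k j + b i k * |b k j|` is always
even, so the integer division by `2` is exact. -/
def matrixMutation {n : ℕ} (k : Fin n) (B : Matrix (Fin n) (Fin n) ℤ) :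
    Matrix (Fin n) (Fin n) ℤ :=
  Matrix.of fun i j =>
    if i = k ∨ j = k then -B i j
    else B i j + (|B i k| * B k j + B i k * |B k j|) / 2

/-- `B` is acyclic if the directed graph on `Fin n` with an edge `i → j` whenever `0 < b i j`
has no oriented cycles. -/
def IsAcyclicMatrix {n : ℕ} (B : Matrix (Fin n) (Fin n) ℤ) : Prop :=
  ∀ i, ¬ Relation.TransGen (fun i j => 0 < B i j) i i

section Seeds

variable (P : Type u) [CommGroup P] [IsMulTorsionFree P]
  (F : Type v) [Field F] [Algebra (GroundField P) F]

/-- A (labeled) seed of rank `n` in the ambient field `F`: a cluster `x`, which is a transcendence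
basis of `F` over the field of fractions of `ℤP`; a coefficient tuple `(pPos i, pNeg i)` of
elements of `P`; and a sign-skew-symmetric integer exchange matrix `B`. -/
structure Seed (n : ℕ) where
  x : Fin n → F
  isTranscendenceBasis : IsTranscendenceBasis (GroundField P) x
  pPos : Fin n → P
  pNeg : Fin n → P
  B : Matrix (Fin n) (Fin n) ℤ
  isSignSkewSymmetric : IsSignSkewSymmetric B

end Seeds

namespace Seed

variable {P : Type u} [CommGroup P] [IsMulTorsionFree P]
  {F : Type v} [Field F] [Algebra (GroundField P) F] [Algebra (GroundRing P) F] {n : ℕ}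

/-- The right-hand side of the exchange relation in direction `j`,
`p⁺ j * ∏_{b i j > 0} (x i) ^ (b i j) + p⁻ j * ∏_{b i j < 0} (x i) ^ (- b i j)`,
as an element of the ambient field. -/
noncomputable def exchangeElement (S : Seed P F n) (j : Fin n) : F :=
  algebraMap (GroundRing P) F (MonoidAlgebra.of ℤ P (S.pPos j)) *
      ∏ i with 0 < S.B i j, S.x i ^ (S.B i j).toNat +
    algebraMap (GroundRing P) F (MonoidAlgebra.of ℤ P (S.pNeg j)) *
      ∏ i with S.B i j < 0, S.x i ^ (-S.B i j).toNat

/-- `S'` is obtained from `S` by a seed mutation in direction `k`. As the coefficients of `S'`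
are constrained only through the ratios `p⁺ i / p⁻ i` for `i ≠ k`, the seed `S'` is not
determined by `S` and `k`. -/
structure IsMutation (k : Fin n) (S S' : Seed P F n) : Prop where
  x_of_ne : ∀ i, i ≠ k → S'.x i = S.x i
  exchange : S.x k * S'.x k = S.exchangeElement k
  pPos_self : S'.pPos k = S.pNeg k
  pNeg_self : S'.pNeg k = S.pPos k
  ratio_of_nonneg : ∀ i, i ≠ k → 0 ≤ S.B k i →
    S'.pPos i / S'.pNeg i = S.pPos k ^ S.B k i * (S.pPos i / S.pNeg i)
  ratio_of_nonpos : ∀ i, i ≠ k → S.B k i ≤ 0 →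
    S'.pPos i / S'.pNeg i = S.pNeg k ^ S.B k i * (S.pPos i / S.pNeg i)
  matrix_eq : S'.B = matrixMutation k S.B

/-- Mutation equivalence of seeds: the equivalence relation generated by seed mutations in all
directions. -/
def MutationEquivalent (S S' : Seed P F n) : Prop :=
  Relation.EqvGen (fun T T' : Seed P F n => ∃ k, IsMutation k T T') S S'

/-- A seed is acyclic if its exchange matrix is. -/
def IsAcyclic (S : Seed P F n) : Prop := IsAcyclicMatrix S.B

/-- The cluster algebra of the seed `S`: the `ℤP`-subalgebra of the ambient field generated by
all cluster variables of all seeds mutation equivalent to `S`. -/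
noncomputable def clusterAlgebra (S : Seed P F n) : Subalgebra (GroundRing P) F :=
  Algebra.adjoin (GroundRing P)
    {z : F | ∃ S' : Seed P F n, MutationEquivalent S S' ∧ ∃ i, S'.x i = z}

end Seed

end ClusterAlgebra

set_option linter.unusedSectionVars false

namespace ClusterAlgebra

universe u v

section GroundRing

variable (P : Type u) [CommGroup P] [IsMulTorsionFree P]

instance twoUniqueProds_of_isMulTorsionFree : TwoUniqueProds P := by
  have h : TwoUniqueSums (Additive P) :=
    TwoUniqueSums.of_injective_addHom
      (DivisibleHull.coeAddMonoidHom (M := Additive P)).toAddHom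
      (DivisibleHull.coe_injective (M := Additive P)) inferInstance
  exact TwoUniqueProds.of_injective_mulHom
    (⟨fun p => Multiplicative.ofAdd (Additive.ofMul p), fun _ _ => rfl⟩ :
      P →ₙ* Multiplicative (Additive P)) (fun _ _ h => h) inferInstance

instance : IsDomain (GroundRing P) := NoZeroDivisors.to_isDomain _

end GroundRing

section AlgebraicIndependence

variable {K : Type*} [Field K] {E : Type*} [Field E] [Algebra K E] {ι : Type*}

/-- Replacing one member `x k` of an algebraically independent family by `Q / x k`, where `Q ≠ 0`
lies in the field generated by the other members, preserves algebraic independence. -/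
lemma algebraicIndependent_update [DecidableEq ι] {x : ι → E} (hx : AlgebraicIndependent K x)
    (k : ι) {y Q : E} (hQ : Q ∈ IntermediateField.adjoin K (x '' {k}ᶜ)) (hQ0 : Q ≠ 0)
    (h : x k * y = Q) : AlgebraicIndependent K (Function.update x k y) := by
  rw [AlgebraicIndependent.iff_transcendental_adjoin_image k] at hx ⊢
  have himg : Function.update x k y '' {k}ᶜ = x '' {k}ᶜ :=
    Set.image_congr fun j hj => Function.update_of_ne hj _ _
  have hfam : (fun j : {j // j ≠ k} => Function.update x k y j) = fun j : {j // j ≠ k} => x j :=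
    funext fun j => Function.update_of_ne j.2 _ _
  rw [himg, hfam, Function.update_self]
  refine ⟨hx.1, ?_⟩
  have h2 := hx.2
  rw [← IntermediateField.transcendental_adjoin_iff] at h2 ⊢
  intro hy
  apply h2
  have hy0 : y ≠ 0 := by rintro rfl; simp at h; exact hQ0 h.symm
  have : x k = algebraMap (IntermediateField.adjoin K (x '' {k}ᶜ)) E ⟨Q, hQ⟩ * y⁻¹ := by
    rw [eq_mul_inv_iff_mul_eq₀ hy0, h]; rfl
  rw [this]
  exact isAlgebraic_algebraMap _ |>.mul hy.inv

lemma transcendental_adjoin_compl {x : ι → E} (hx : AlgebraicIndependent K x) (k : ι) :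
    Transcendental (IntermediateField.adjoin K (x '' {k}ᶜ)) (x k) := by
  rw [IntermediateField.transcendental_adjoin_iff]
  exact ((AlgebraicIndependent.iff_transcendental_adjoin_image k).1 hx).2

lemma isTranscendenceBasis_of_algebraicIndependent [Finite ι] {x y : ι → E}
    (hx : IsTranscendenceBasis K x) (hy : AlgebraicIndependent K y) :
    IsTranscendenceBasis K y :=
  hy.isTranscendenceBasis_of_lift_trdeg_le_of_finite hx.lift_cardinalMk_eq_trdeg.ge

end AlgebraicIndependence

/-- The binomial `c ∏ x i ^ [b i]₊ + c' ∏ x i ^ [-b i]₊`. -/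
def binomial {E : Type*} [CommSemiring E] {n : ℕ} (c c' : E) (x : Fin n → E) (b : Fin n → ℤ) : E :=
  c * ∏ i, x i ^ (b i).toNat + c' * ∏ i, x i ^ (-b i).toNat

lemma binomial_mem_adjoin {K E : Type*} [Field K] [Field E] [Algebra K E] {n : ℕ} (c c' : K)
    (x : Fin n → E) (b : Fin n → ℤ) (k : Fin n) (hb : b k = 0) :
    binomial (algebraMap K E c) (algebraMap K E c') x b ∈
      IntermediateField.adjoin K (x '' {k}ᶜ) := by
  have key : ∀ i, ∀ m : ℕ, (i = k → m = 0) → x i ^ m ∈ IntermediateField.adjoin K (x '' {k}ᶜ) := by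
    intro i m hm
    by_cases hik : i = k
    · rw [hm hik, pow_zero]; exact one_mem _
    · exact pow_mem (IntermediateField.subset_adjoin K (x '' {k}ᶜ) ⟨i, hik, rfl⟩) _
  refine add_mem (mul_mem (algebraMap_mem _ _) (prod_mem fun i _ => key i _ ?_))
    (mul_mem (algebraMap_mem _ _) (prod_mem fun i _ => key i _ ?_)) <;>
  · rintro rfl; simp [hb]

lemma binomial_ne_zero {K E : Type*} [Field K] [Field E] [Algebra K E] {n : ℕ} {c c' : K}
    (hc : c ≠ 0) (hcc : c + c' ≠ 0) {x : Fin n → E}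
    (hx : AlgebraicIndependent K x) (b : Fin n → ℤ) :
    binomial (algebraMap K E c) (algebraMap K E c') x b ≠ 0 := by
  set α : Fin n →₀ ℕ := Finsupp.equivFunOnFinite.symm fun i => (b i).toNat
  set β : Fin n →₀ ℕ := Finsupp.equivFunOnFinite.symm fun i => (-b i).toNat
  have h : binomial (algebraMap K E c) (algebraMap K E c') x b =
      MvPolynomial.aeval x (MvPolynomial.monomial α c + MvPolynomial.monomial β c') := by
    simp [binomial, MvPolynomial.aeval_monomial, Finsupp.prod_fintype, α, β]
  rw [h]
  intro h0
  have h1 := (injective_iff_map_eq_zero _).1 hx _ h0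
  have h2 := congrArg (MvPolynomial.coeff α) h1
  rw [MvPolynomial.coeff_add, MvPolynomial.coeff_monomial, MvPolynomial.coeff_monomial,
    MvPolynomial.coeff_zero, if_pos rfl] at h2
  split_ifs at h2
  · exact hcc h2
  · exact hc (by simpa using h2)

section MatrixMutation

lemma mutation_term (b c : ℤ) :
    (|b| * c + b * |c|) / 2 = max b 0 * max c 0 - max (-b) 0 * max (-c) 0 := by
  rcases le_total 0 b with hb | hb <;> rcases le_total 0 c with hc | hc
  · rw [abs_of_nonneg hb, abs_of_nonneg hc, max_eq_left hb, max_eq_left hc,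
      max_eq_right (by omega : -b ≤ 0)]
    rw [show b * c + b * c = 2 * (b * c) by ring]; simp
  · rw [abs_of_nonneg hb, abs_of_nonpos hc, max_eq_left hb, max_eq_right hc,
      max_eq_right (by omega : -b ≤ 0)]
    simp
  · rw [abs_of_nonpos hb, abs_of_nonneg hc, max_eq_right hb, max_eq_left hc,
      max_eq_right (by omega : -c ≤ 0)]
    simp
  · rw [abs_of_nonpos hb, abs_of_nonpos hc, max_eq_right hb, max_eq_right hc,
      max_eq_left (by omega : 0 ≤ -b), max_eq_left (by omega : 0 ≤ -c)]
    rw [show -b * c + b * -c = 2 * (-(b * c)) by ring, Int.mul_ediv_cancel_left _ two_ne_zero]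
    ring

variable {n : ℕ} (B : Matrix (Fin n) (Fin n) ℤ) (k : Fin n)

lemma matrixMutation_left (j : Fin n) : matrixMutation k B k j = -B k j := by
  simp [matrixMutation]

lemma matrixMutation_right (i : Fin n) : matrixMutation k B i k = -B i k := by
  simp [matrixMutation]

lemma matrixMutation_of_ne {i j : Fin n} (hi : i ≠ k) (hj : j ≠ k) :
    matrixMutation k B i j =
      B i j + (max (B i k) 0 * max (B k j) 0 - max (-B i k) 0 * max (-B k j) 0) := by
  simp [matrixMutation, hi, hj, mutation_term]

lemma matrixMutation_matrixMutation : matrixMutation k (matrixMutation k B) = B := by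
  ext i j
  by_cases hi : i = k
  · subst hi; rw [matrixMutation_left, matrixMutation_left, neg_neg]
  by_cases hj : j = k
  · subst hj; rw [matrixMutation_right, matrixMutation_right, neg_neg]
  rw [matrixMutation_of_ne _ _ hi hj, matrixMutation_left, matrixMutation_right,
    matrixMutation_of_ne _ _ hi hj]
  simp only [neg_neg]
  ring

lemma IsSkewSymmetrizable.matrixMutation {B : Matrix (Fin n) (Fin n) ℤ}
    (h : IsSkewSymmetrizable B) (k : Fin n) : IsSkewSymmetrizable (matrixMutation k B) := by
  obtain ⟨d, hd, hB⟩ := h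
  refine ⟨d, hd, fun i j => ?_⟩
  by_cases hi : i = k
  · subst hi
    rw [matrixMutation_left, matrixMutation_right]; push_cast; linarith [hB i j]
  by_cases hj : j = k
  · subst hj
    rw [matrixMutation_left, matrixMutation_right]; push_cast; linarith [hB i j]
  rw [matrixMutation_of_ne _ _ hi hj, matrixMutation_of_ne _ _ hj hi]
  have e1 : ∀ a b : Fin n, d a * max (B a b : ℝ) 0 = d b * max (-B b a : ℝ) 0 := by
    intro a b
    rw [mul_max_of_nonneg _ _ (hd a).le, mul_max_of_nonneg _ _ (hd b).le, hB a b]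
    ring_nf
  have e2 : ∀ a b : Fin n, d a * max (-B a b : ℝ) 0 = d b * max (B b a : ℝ) 0 :=
    fun a b => (e1 b a).symm
  push_cast
  have := hB i j
  have h1 := e1 i k
  have h2 := e2 i k
  have h3 := e1 k j
  have h4 := e2 k j
  linear_combination this + max (B k j : ℝ) 0 * h1 - max (-B k j : ℝ) 0 * h2
    + max (-B k i : ℝ) 0 * h3 - max (B k i : ℝ) 0 * h4

lemma IsSkewSymmetrizable.isSignSkewSymmetric {B : Matrix (Fin n) (Fin n) ℤ}
    (h : IsSkewSymmetrizable B) : IsSignSkewSymmetric B := by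
  obtain ⟨d, hd, hB⟩ := h
  intro i j
  have hij := hB i j
  by_cases h0 : B i j = 0
  · left
    refine ⟨h0, ?_⟩
    rw [h0] at hij
    have : d j * (B j i : ℝ) = 0 := by push_cast at hij; linarith
    rcases mul_eq_zero.1 this with h | h
    · exact absurd h (hd j).ne'
    · exact_mod_cast h
  · right
    have h1 : 0 < d j * (-(B i j * B j i : ℝ)) := by
      have : d j * (-(B i j * B j i : ℝ)) = d i * (B i j : ℝ) ^ 2 := by
        linear_combination (-(B i j : ℝ)) * hij
      rw [this]
      have : (B i j : ℝ) ≠ 0 := by exact_mod_cast h0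
      have := hd i
      positivity
    have h2 : (0 : ℝ) < -(B i j * B j i : ℝ) := (mul_pos_iff_of_pos_left (hd j)).1 h1
    have : ((B i j * B j i : ℤ) : ℝ) < 0 := by push_cast; linarith
    exact_mod_cast this

lemma IsSignSkewSymmetric.diag {B : Matrix (Fin n) (Fin n) ℤ} (h : IsSignSkewSymmetric B)
    (i : Fin n) : B i i = 0 := by
  rcases h i i with h | h
  · exact h.1
  · nlinarith [mul_self_nonneg (B i i)]

end MatrixMutation

namespace Seed

variable {P : Type u} [CommGroup P] [IsMulTorsionFree P]
  {F : Type v} [Field F] [Algebra (GroundField P) F] [Algebra (GroundRing P) F] {n : ℕ}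

variable (F) in
/-- The coefficient group, mapped to the ambient field. -/
noncomputable def coeffHom : P →* F :=
  (algebraMap (GroundRing P) F).toMonoidHom.comp (MonoidAlgebra.of ℤ P)

lemma coeffHom_ne_zero (p : P) : coeffHom F p ≠ 0 := ((Group.isUnit p).map (coeffHom F)).ne_zero

lemma exchangeElement_eq (S : Seed P F n) (k : Fin n) :
    S.exchangeElement k =
      binomial (coeffHom F (S.pPos k)) (coeffHom F (S.pNeg k)) S.x (fun i => S.B i k) := by
  unfold exchangeElement binomial
  congr 2
  · rw [Finset.prod_filter]
    refine Finset.prod_congr rfl fun i _ => ?_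
    split_ifs with h
    · rfl
    · rw [Int.toNat_of_nonpos (by simpa using h), pow_zero]
  · rw [Finset.prod_filter]
    refine Finset.prod_congr rfl fun i _ => ?_
    split_ifs with h
    · rfl
    · rw [Int.toNat_of_nonpos (by simpa using h), pow_zero]

lemma x_ne_zero (S : Seed P F n) (i : Fin n) : S.x i ≠ 0 := S.isTranscendenceBasis.1.ne_zero i

lemma of_add_of_ne_zero (p q : P) :
    algebraMap (GroundRing P) (GroundField P) (MonoidAlgebra.of ℤ P p) +
      algebraMap (GroundRing P) (GroundField P) (MonoidAlgebra.of ℤ P q) ≠ 0 := by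
  rw [← map_add, Ne, map_eq_zero_iff _ (IsFractionRing.injective (GroundRing P) (GroundField P))]
  intro h
  have := congrArg (MonoidAlgebra.lift ℤ ℤ P (1 : P →* ℤ)) h
  simp at this

lemma of_ne_zero (p : P) :
    algebraMap (GroundRing P) (GroundField P) (MonoidAlgebra.of ℤ P p) ≠ 0 :=
  ((Group.isUnit p).map ((algebraMap (GroundRing P) (GroundField P)).toMonoidHom.comp
    (MonoidAlgebra.of ℤ P))).ne_zero

variable [IsScalarTower (GroundRing P) (GroundField P) F]

lemma coeffHom_eq (p : P) : coeffHom F p = algebraMap (GroundField P) F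
    (algebraMap (GroundRing P) (GroundField P) (MonoidAlgebra.of ℤ P p)) := by
  rw [← IsScalarTower.algebraMap_apply]; rfl

lemma exchangeElement_ne_zero (S : Seed P F n) (k : Fin n) : S.exchangeElement k ≠ 0 := by
  rw [exchangeElement_eq, coeffHom_eq, coeffHom_eq]
  exact binomial_ne_zero (of_ne_zero _) (of_add_of_ne_zero _ _) S.isTranscendenceBasis.1 _

lemma exchangeElement_mem_adjoin (S : Seed P F n) (k : Fin n) :
    S.exchangeElement k ∈ IntermediateField.adjoin (GroundField P) (S.x '' {k}ᶜ) := by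
  rw [exchangeElement_eq, coeffHom_eq, coeffHom_eq]
  exact binomial_mem_adjoin _ _ _ _ _ (S.isSignSkewSymmetric.diag k)

/-- The cluster variable obtained from `S` by exchanging `x k`. -/
noncomputable def x' (S : Seed P F n) (k : Fin n) : F := S.exchangeElement k / S.x k

lemma x_mul_x' (S : Seed P F n) (k : Fin n) : S.x k * S.x' k = S.exchangeElement k :=
  mul_div_cancel₀ _ (S.x_ne_zero k)

lemma x'_ne_zero (S : Seed P F n) (k : Fin n) : S.x' k ≠ 0 :=
  div_ne_zero (S.exchangeElement_ne_zero k) (S.x_ne_zero k)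

lemma isTranscendenceBasis_update (S : Seed P F n) (k : Fin n) :
    IsTranscendenceBasis (GroundField P) (Function.update S.x k (S.x' k)) :=
  isTranscendenceBasis_of_algebraicIndependent S.isTranscendenceBasis
    (algebraicIndependent_update S.isTranscendenceBasis.1 k (S.exchangeElement_mem_adjoin k)
      (S.exchangeElement_ne_zero k) (S.x_mul_x' k))

lemma IsMutation.x_self {k : Fin n} {S S' : Seed P F n} (h : IsMutation k S S') :
    S'.x k = S.x' k := by
  rw [x', eq_div_iff (S.x_ne_zero k), mul_comm, h.exchange]

lemma IsMutation.x_eq {k : Fin n} {S S' : Seed P F n} (h : IsMutation k S S') :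
    S'.x = Function.update S.x k (S.x' k) := by
  funext i
  by_cases hi : i = k
  · subst hi; rw [Function.update_self, h.x_self]
  · rw [Function.update_of_ne hi, h.x_of_ne i hi]

/-- The seed obtained by mutation, for a given choice of the coefficients in directions other than
`k`. -/
noncomputable def mutate (S : Seed P F n) (k : Fin n) (pPos pNeg : Fin n → P)
    (hB : IsSignSkewSymmetric (matrixMutation k S.B)) : Seed P F n where
  x := Function.update S.x k (S.x' k)
  isTranscendenceBasis := S.isTranscendenceBasis_update k
  pPos := Function.update pPos k (S.pNeg k)
  pNeg := Function.update pNeg k (S.pPos k)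
  B := matrixMutation k S.B
  isSignSkewSymmetric := hB

lemma isMutation_mutate (S : Seed P F n) (k : Fin n) (pPos pNeg : Fin n → P)
    (hB : IsSignSkewSymmetric (matrixMutation k S.B))
    (h1 : ∀ i, i ≠ k → 0 ≤ S.B k i →
      pPos i / pNeg i = S.pPos k ^ S.B k i * (S.pPos i / S.pNeg i))
    (h2 : ∀ i, i ≠ k → S.B k i ≤ 0 →
      pPos i / pNeg i = S.pNeg k ^ S.B k i * (S.pPos i / S.pNeg i)) :
    IsMutation k S (S.mutate k pPos pNeg hB) where
  x_of_ne i hi := Function.update_of_ne hi _ _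
  exchange := by simp [mutate, x_mul_x']
  pPos_self := by simp [mutate]
  pNeg_self := by simp [mutate]
  ratio_of_nonneg i hi hb := by simp [mutate, hi, h1 i hi hb]
  ratio_of_nonpos i hi hb := by simp [mutate, hi, h2 i hi hb]
  matrix_eq := rfl

lemma exists_isMutation (S : Seed P F n) (k : Fin n)
    (hB : IsSignSkewSymmetric (matrixMutation k S.B)) : ∃ S', IsMutation k S S' := by
  refine ⟨_, isMutation_mutate S k (fun i => if 0 ≤ S.B k i then
    S.pPos k ^ S.B k i * (S.pPos i / S.pNeg i) else S.pNeg k ^ S.B k i * (S.pPos i / S.pNeg i))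
    (fun _ => 1) hB ?_ ?_⟩
  · intro i _ hb
    simp [hb]
  · intro i _ hb
    rcases hb.lt_or_eq with hb | hb
    · simp [hb.not_ge]
    · simp [hb]

lemma IsMutation.exchangeElement_self {k : Fin n} {S S' : Seed P F n} (h : IsMutation k S S') :
    S'.exchangeElement k = S.exchangeElement k := by
  rw [exchangeElement_eq, exchangeElement_eq, h.pPos_self, h.pNeg_self, h.matrix_eq]
  unfold binomial
  rw [add_comm]
  have key : ∀ i, ∀ f : ℤ → ℕ, f 0 = 0 → S'.x i ^ f (S.B i k) = S.x i ^ f (S.B i k) := by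
    intro i f hf
    by_cases hi : i = k
    · subst hi; rw [S.isSignSkewSymmetric.diag, hf, pow_zero, pow_zero]
    · rw [h.x_of_ne i hi]
  congr 2
  · refine Finset.prod_congr rfl fun i _ => ?_
    simp only [matrixMutation_right, neg_neg]
    rw [key i (fun b => b.toNat) rfl]
  · refine Finset.prod_congr rfl fun i _ => ?_
    simp only [matrixMutation_right]
    rw [key i (fun b => (-b).toNat) rfl]

lemma IsMutation.symm {k : Fin n} {S S' : Seed P F n} (h : IsMutation k S S') :
    IsMutation k S' S where
  x_of_ne i hi := (h.x_of_ne i hi).symm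
  exchange := by rw [h.exchangeElement_self, ← h.exchange, mul_comm]
  pPos_self := h.pNeg_self.symm
  pNeg_self := h.pPos_self.symm
  ratio_of_nonneg i hi hb := by
    rw [h.matrix_eq, matrixMutation_left] at hb
    rw [h.matrix_eq, matrixMutation_left, h.pPos_self, h.ratio_of_nonpos i hi (by omega)]
    simp
  ratio_of_nonpos i hi hb := by
    rw [h.matrix_eq, matrixMutation_left] at hb
    rw [h.matrix_eq, matrixMutation_left, h.pNeg_self, h.ratio_of_nonneg i hi (by omega)]
    simp
  matrix_eq := by rw [h.matrix_eq, matrixMutation_matrixMutation]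

lemma MutationEquivalent.trans {S T U : Seed P F n} (h : S.MutationEquivalent T)
    (h' : T.MutationEquivalent U) : S.MutationEquivalent U := Relation.EqvGen.trans _ _ _ h h'

lemma MutationEquivalent.symm {S T : Seed P F n} (h : S.MutationEquivalent T) :
    T.MutationEquivalent S := Relation.EqvGen.symm _ _ h

lemma IsMutation.mutationEquivalent {k : Fin n} {S T : Seed P F n} (h : IsMutation k S T) :
    S.MutationEquivalent T := Relation.EqvGen.rel _ _ ⟨k, h⟩

/-- Induction along sequences of mutations. -/
lemma MutationEquivalent.induction {S : Seed P F n} {motive : Seed P F n → Prop}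
    (base : motive S)
    (step : ∀ T T' k, S.MutationEquivalent T → IsMutation k T T' → motive T → motive T')
    {T : Seed P F n} (h : S.MutationEquivalent T) : motive T := by
  have key : ∀ T T' : Seed P F n, T.MutationEquivalent T' →
      ((S.MutationEquivalent T → motive T → motive T') ∧
        (S.MutationEquivalent T' → motive T' → motive T)) := by
    intro T T' hTT'
    induction hTT' with
    | rel T T' h =>
      obtain ⟨k, hk⟩ := h
      exact ⟨fun a b => step T T' k a hk b, fun a b => step T' T k a hk.symm b⟩
    | refl T => exact ⟨fun _ h => h, fun _ h => h⟩
    | symm T T' _ ih => exact ih.symm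
    | trans T U V h1 h2 ih1 ih2 =>
      exact ⟨fun a b => ih2.1 (a.trans h1) (ih1.1 a b),
        fun a b => ih1.2 (a.trans (MutationEquivalent.symm h2)) (ih2.2 a b)⟩
  exact (key S T h).1 (Relation.EqvGen.refl _) base

lemma MutationEquivalent.isSkewSymmetrizable {S T : Seed P F n} (h : S.MutationEquivalent T)
    (hS : IsSkewSymmetrizable S.B) : IsSkewSymmetrizable T.B := by
  refine h.induction (motive := fun T => IsSkewSymmetrizable T.B) hS fun T T' k _ h ih => ?_
  rw [h.matrix_eq]; exact ih.matrixMutation k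

lemma exists_isMutation_of_isSkewSymmetrizable (S : Seed P F n) (k : Fin n)
    (hB : IsSkewSymmetrizable S.B) : ∃ S', IsMutation k S S' :=
  S.exists_isMutation k (hB.matrixMutation k).isSignSkewSymmetric

lemma clusterAlgebra_eq_of_mutationEquivalent {S T : Seed P F n} (h : S.MutationEquivalent T) :
    S.clusterAlgebra = T.clusterAlgebra := by
  unfold clusterAlgebra
  congr 1
  ext z
  exact ⟨fun ⟨U, hU, hz⟩ => ⟨U, h.symm.trans hU, hz⟩, fun ⟨U, hU, hz⟩ => ⟨U, h.trans hU, hz⟩⟩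

end Seed

section PartialMap

variable {A F₁ F₂ : Type*} [CommRing A] [Field F₁] [Field F₂]

/-- The partially defined map `F₁ → F₂` sending `α a / α b` to `β a / β b` whenever the
denominators do not vanish, as a relation. -/
def PartialMap (α : A →+* F₁) (β : A →+* F₂) (u : F₁) (w : F₂) : Prop :=
  ∃ a b, α b ≠ 0 ∧ β b ≠ 0 ∧ u * α b = α a ∧ w * β b = β a

namespace PartialMap

variable {α : A →+* F₁} {β : A →+* F₂}

lemma of (a : A) : PartialMap α β (α a) (β a) := ⟨a, 1, by simp, by simp, by simp, by simp⟩

lemma one : PartialMap α β 1 1 := by simpa using of (α := α) (β := β) 1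

lemma add {u₁ u₂ : F₁} {w₁ w₂ : F₂} (h₁ : PartialMap α β u₁ w₁) (h₂ : PartialMap α β u₂ w₂) :
    PartialMap α β (u₁ + u₂) (w₁ + w₂) := by
  obtain ⟨a, b, h1, h2, h3, h4⟩ := h₁
  obtain ⟨a', b', h1', h2', h3', h4'⟩ := h₂
  refine ⟨a * b' + a' * b, b * b', by simp [h1, h1'], by simp [h2, h2'], ?_, ?_⟩
  · simp only [map_add, map_mul]; rw [← h3, ← h3']; ring
  · simp only [map_add, map_mul]; rw [← h4, ← h4']; ring

lemma mul {u₁ u₂ : F₁} {w₁ w₂ : F₂} (h₁ : PartialMap α β u₁ w₁) (h₂ : PartialMap α β u₂ w₂) :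
    PartialMap α β (u₁ * u₂) (w₁ * w₂) := by
  obtain ⟨a, b, h1, h2, h3, h4⟩ := h₁
  obtain ⟨a', b', h1', h2', h3', h4'⟩ := h₂
  refine ⟨a * a', b * b', by simp [h1, h1'], by simp [h2, h2'], ?_, ?_⟩
  · simp only [map_mul]; rw [← h3, ← h3']; ring
  · simp only [map_mul]; rw [← h4, ← h4']; ring

lemma pow {u : F₁} {w : F₂} (h : PartialMap α β u w) (n : ℕ) :
    PartialMap α β (u ^ n) (w ^ n) := by
  induction n with
  | zero => simpa using one
  | succ n ih => rw [pow_succ, pow_succ]; exact ih.mul h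

lemma prod {ι : Type*} {u : ι → F₁} {w : ι → F₂} (s : Finset ι)
    (h : ∀ i, PartialMap α β (u i) (w i)) : PartialMap α β (∏ i ∈ s, u i) (∏ i ∈ s, w i) := by
  classical
  induction s using Finset.induction_on with
  | empty => simpa using one
  | insert i s hi ih => rw [Finset.prod_insert hi, Finset.prod_insert hi]; exact (h i).mul ih

lemma inv (hker : ∀ a, α a = 0 → β a = 0) {u : F₁} {w : F₂} (h : PartialMap α β u w)
    (hw : w ≠ 0) : PartialMap α β u⁻¹ w⁻¹ := by
  obtain ⟨a, b, h1, h2, h3, h4⟩ := h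
  have hβ : β a ≠ 0 := by rw [← h4]; exact mul_ne_zero hw h2
  have hα : α a ≠ 0 := fun h => hβ (hker a h)
  have hu : u ≠ 0 := by rintro rfl; exact hα (by rw [← h3, zero_mul])
  exact ⟨b, a, hα, hβ, by rw [← h3, inv_mul_cancel_left₀ hu],
    by rw [← h4, inv_mul_cancel_left₀ hw]⟩

lemma div (hker : ∀ a, α a = 0 → β a = 0) {u₁ u₂ : F₁} {w₁ w₂ : F₂}
    (h₁ : PartialMap α β u₁ w₁) (h₂ : PartialMap α β u₂ w₂) (hw : w₂ ≠ 0) :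
    PartialMap α β (u₁ / u₂) (w₁ / w₂) := by
  rw [div_eq_mul_inv, div_eq_mul_inv]
  exact h₁.mul (h₂.inv hker hw)

lemma unique (hker : ∀ a, α a = 0 → β a = 0) {u : F₁} {w w' : F₂} (h : PartialMap α β u w)
    (h' : PartialMap α β u w') : w = w' := by
  obtain ⟨a, b, h1, h2, h3, h4⟩ := h
  obtain ⟨a', b', h1', h2', h3', h4'⟩ := h'
  have : α (a * b' - a' * b) = 0 := by
    simp only [map_sub, map_mul]; rw [← h3, ← h3']; ring
  have := hker _ this
  simp only [map_sub, map_mul] at this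
  rw [← h4, ← h4'] at this
  have h5 : (w - w') * (β b * β b') = 0 := by linear_combination this
  rcases mul_eq_zero.1 h5 with h | h
  · exact sub_eq_zero.1 h
  · exact absurd h (mul_ne_zero h2 h2')

lemma binomial {n : ℕ} {c c' : F₁} {d d' : F₂} {x : Fin n → F₁} {y : Fin n → F₂}
    (hc : PartialMap α β c d) (hc' : PartialMap α β c' d') (hx : ∀ i, PartialMap α β (x i) (y i))
    (b : Fin n → ℤ) :
    PartialMap α β (ClusterAlgebra.binomial c c' x b) (ClusterAlgebra.binomial d d' y b) :=
  (hc.mul (prod _ fun i => (hx i).pow _)).add (hc'.mul (prod _ fun i => (hx i).pow _))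

/-- A subalgebra generated by elements whose images lie in a subring `W` has images in `W`. -/
lemma exists_of_mem_adjoin {R : Type*} [CommRing R] [Algebra R F₁] {s : Set F₁} {W : Subring F₂}
    (hR : ∀ r : R, ∃ w ∈ W, PartialMap α β (algebraMap R F₁ r) w)
    (hs : ∀ u ∈ s, ∃ w ∈ W, PartialMap α β u w) {u : F₁} (hu : u ∈ Algebra.adjoin R s) :
    ∃ w ∈ W, PartialMap α β u w := by
  induction hu using Algebra.adjoin_induction with
  | mem u hu => exact hs u hu
  | algebraMap r => exact hR r
  | add x y _ _ hx hy =>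
    obtain ⟨w, hw, h⟩ := hx
    obtain ⟨w', hw', h'⟩ := hy
    exact ⟨_, add_mem hw hw', h.add h'⟩
  | mul x y _ _ hx hy =>
    obtain ⟨w, hw, h⟩ := hx
    obtain ⟨w', hw', h'⟩ := hy
    exact ⟨_, mul_mem hw hw', h.mul h'⟩

end PartialMap

end PartialMap

section HasLead

variable {E : Type*} [Field E]

/-- The Hahn series `w` has leading term `l * t ^ a`. -/
def HasLead (w : HahnSeries ℝ E) (a : ℝ) (l : E) : Prop := w.orderTop = a ∧ w.coeff a = l

namespace HasLead

variable {w w' : HahnSeries ℝ E} {a a' : ℝ} {l l' : E}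

lemma lead_ne_zero (h : HasLead w a l) : l ≠ 0 := h.2 ▸ HahnSeries.coeff_orderTop_ne h.1

lemma ne_zero (h : HasLead w a l) : w ≠ 0 := by
  rintro rfl
  exact h.lead_ne_zero (by rw [← h.2, HahnSeries.coeff_zero])

lemma leadingCoeff_eq (h : HasLead w a l) : w.leadingCoeff = l := by
  have h1 := HahnSeries.order_eq_orderTop_of_ne_zero h.ne_zero
  rw [h.1] at h1
  rw [HahnSeries.leadingCoeff_eq, WithTop.coe_injective h1, h.2]

lemma of_leadingCoeff (h : w.orderTop = a) (h' : w.leadingCoeff = l) : HasLead w a l := by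
  refine ⟨h, ?_⟩
  have h0 : w ≠ 0 := by
    rintro rfl
    simp at h
  have h1 := HahnSeries.order_eq_orderTop_of_ne_zero h0
  rw [h] at h1
  rw [← h', HahnSeries.leadingCoeff_eq, WithTop.coe_injective h1]

lemma mul (h : HasLead w a l) (h' : HasLead w' a' l') : HasLead (w * w') (a + a') (l * l') :=
  of_leadingCoeff (by rw [HahnSeries.orderTop_mul, h.1, h'.1]; rfl)
    (by rw [HahnSeries.leadingCoeff_mul, h.leadingCoeff_eq, h'.leadingCoeff_eq])

lemma single (hl : l ≠ 0) : HasLead (HahnSeries.single a l) a l :=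
  ⟨HahnSeries.orderTop_single hl, HahnSeries.coeff_single_same _ _⟩

lemma const (hl : l ≠ 0) : HasLead (HahnSeries.C l : HahnSeries ℝ E) 0 l := single hl

lemma pow (h : HasLead w a l) (n : ℕ) : HasLead (w ^ n) (n * a) (l ^ n) := by
  induction n with
  | zero => simpa using const (E := E) one_ne_zero
  | succ n ih =>
    rw [pow_succ, pow_succ]; push_cast; rw [add_one_mul]; exact ih.mul h

lemma prod {ι : Type*} {w : ι → HahnSeries ℝ E} {a : ι → ℝ} {l : ι → E} (s : Finset ι)
    (h : ∀ i, HasLead (w i) (a i) (l i)) :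
    HasLead (∏ i ∈ s, w i) (∑ i ∈ s, a i) (∏ i ∈ s, l i) := by
  classical
  induction s using Finset.induction_on with
  | empty => simpa using const (E := E) one_ne_zero
  | insert i s hi ih =>
    rw [Finset.prod_insert hi, Finset.prod_insert hi, Finset.sum_insert hi]; exact (h i).mul ih

lemma div (h : HasLead w a l) (h' : HasLead w' a' l') : HasLead (w / w') (a - a') (l / l') := by
  have h0 : w / w' ≠ 0 := div_ne_zero h.ne_zero h'.ne_zero
  have h1 : HasLead (w / w') (w / w').order (w / w').leadingCoeff :=
    of_leadingCoeff (HahnSeries.order_eq_orderTop_of_ne_zero h0).symm rfl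
  have h2 := h1.mul h'
  rw [div_mul_cancel₀ _ h'.ne_zero] at h2
  have h3 : (w / w').order + a' = a := WithTop.coe_injective (h2.1.symm.trans h.1)
  have h4 : (w / w').leadingCoeff * l' = l := h2.leadingCoeff_eq.symm.trans h.leadingCoeff_eq
  rw [← h3, ← h4, add_sub_cancel_right, mul_div_cancel_right₀ _ h'.lead_ne_zero]
  exact h1

lemma add_of_lt (h : HasLead w a l) (h' : HasLead w' a' l') (haa : a < a') :
    HasLead (w + w') a l := by
  have hlt : w.orderTop < w'.orderTop := by rw [h.1, h'.1]; exact_mod_cast haa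
  refine ⟨by rw [HahnSeries.orderTop_add_eq_left hlt, h.1], ?_⟩
  rw [HahnSeries.coeff_add, h.2, HahnSeries.coeff_eq_zero_of_lt_orderTop (by rw [h'.1]; exact_mod_cast haa),
    add_zero]

lemma add_of_eq (h : HasLead w a l) (h' : HasLead w' a l') (hll : l + l' ≠ 0) :
    HasLead (w + w') a (l + l') := by
  have hc : (w + w').coeff a = l + l' := by rw [HahnSeries.coeff_add, h.2, h'.2]
  refine ⟨le_antisymm (HahnSeries.orderTop_le_of_coeff_ne_zero (by rwa [hc])) ?_, hc⟩
  have := HahnSeries.min_orderTop_le_orderTop_add (x := w) (y := w')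
  rwa [h.1, h'.1, min_self] at this

end HasLead

/-- Hahn series of non-negative order. -/
def hahnIntegers (E : Type*) [Field E] : Subring (HahnSeries ℝ E) where
  carrier := {w | 0 ≤ w.orderTop}
  zero_mem' := by simp
  one_mem' := by simp
  add_mem' h h' := by
    rw [Set.mem_ofPred_eq] at *
    exact le_trans (le_min h h') HahnSeries.min_orderTop_le_orderTop_add
  mul_mem' h h' := by
    rw [Set.mem_ofPred_eq] at *
    rw [HahnSeries.orderTop_mul]
    exact add_nonneg h h'
  neg_mem' h := by simpa using h

lemma mem_hahnIntegers {E : Type*} [Field E] {w : HahnSeries ℝ E} :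
    w ∈ hahnIntegers E ↔ 0 ≤ w.orderTop := Iff.rfl

lemma HasLead.mem_hahnIntegers {E : Type*} [Field E] {w : HahnSeries ℝ E} {a : ℝ} {l : E}
    (h : HasLead w a l) : w ∈ hahnIntegers E ↔ 0 ≤ a := by
  rw [ClusterAlgebra.mem_hahnIntegers, h.1]; exact_mod_cast Iff.rfl

/-- The tropical exchange `min (∑ [b i]₊ a i) (∑ [-b i]₊ a i)`. -/
noncomputable def tropicalBinomial {n : ℕ} (b : Fin n → ℤ) (a : Fin n → ℝ) : ℝ :=
  min (∑ i, ((b i).toNat : ℝ) * a i) (∑ i, ((-b i).toNat : ℝ) * a i)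

lemma exists_hasLead_binomial {K E : Type*} [Field K] [Field E] [Algebra K E] {n : ℕ} {c c' : K}
    (hc : c ≠ 0) (hc' : c' ≠ 0) (hcc : c + c' ≠ 0) {w : Fin n → HahnSeries ℝ E} {a : Fin n → ℝ}
    {l : Fin n → E} (h : ∀ i, HasLead (w i) (a i) (l i)) (hl : AlgebraicIndependent K l)
    (b : Fin n → ℤ) (k : Fin n) (hb : b k = 0) :
    ∃ Q ∈ IntermediateField.adjoin K (l '' {k}ᶜ), Q ≠ 0 ∧
      HasLead (binomial (HahnSeries.C (algebraMap K E c)) (HahnSeries.C (algebraMap K E c')) w b)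
        (tropicalBinomial b a) Q := by
  have hC : ∀ c : K, c ≠ 0 → HasLead (HahnSeries.C (algebraMap K E c)) 0 (algebraMap K E c) :=
    fun c hc => HasLead.const (by simpa using hc)
  have h1 := (hC c hc).mul (HasLead.prod Finset.univ fun i => (h i).pow (b i).toNat)
  have h2 := (hC c' hc').mul (HasLead.prod Finset.univ fun i => (h i).pow (-b i).toNat)
  rw [zero_add] at h1 h2
  have key : ∀ m : Fin n → ℕ, m k = 0 → ∀ c : K,
      algebraMap K E c * ∏ i, l i ^ m i ∈ IntermediateField.adjoin K (l '' {k}ᶜ) := by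
    intro m hm c
    refine mul_mem (algebraMap_mem _ _) (prod_mem fun i _ => ?_)
    by_cases hik : i = k
    · rw [hik, hm, pow_zero]; exact one_mem _
    · exact pow_mem (IntermediateField.subset_adjoin K (l '' {k}ᶜ) ⟨i, hik, rfl⟩) _
  unfold tropicalBinomial binomial
  rcases lt_trichotomy (∑ i, ((b i).toNat : ℝ) * a i) (∑ i, ((-b i).toNat : ℝ) * a i) with
    hlt | heq | hlt
  · rw [min_eq_left hlt.le]
    exact ⟨_, key _ (by simp [hb]) c, h1.lead_ne_zero, h1.add_of_lt h2 hlt⟩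
  · rw [← heq, min_self]
    rw [← heq] at h2
    have h0 := binomial_ne_zero hc hcc hl b
    exact ⟨_, binomial_mem_adjoin c c' l b k hb, h0, h1.add_of_eq h2 h0⟩
  · rw [min_eq_right hlt.le]
    rw [add_comm]
    exact ⟨_, key _ (by simp [hb]) c', h2.lead_ne_zero, h2.add_of_lt h1 hlt⟩

end HasLead

namespace Seed

variable {P : Type u} [CommGroup P] [IsMulTorsionFree P]
  {F : Type v} [Field F] [Algebra (GroundField P) F] [Algebra (GroundRing P) F] {n : ℕ}
  [IsScalarTower (GroundRing P) (GroundField P) F]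

/-- Evaluation of polynomials at the cluster of `S`. -/
noncomputable def clusterEval (S : Seed P F n) : MvPolynomial (Fin n) (GroundField P) →+* F :=
  (MvPolynomial.aeval S.x : MvPolynomial (Fin n) (GroundField P) →ₐ[GroundField P] F).toRingHom

/-- Evaluation of polynomials at the cluster of `S`, with `x i` deformed to `x i * t ^ a i`. -/
noncomputable def toricEval (S : Seed P F n) (a : Fin n → ℝ) :
    MvPolynomial (Fin n) (GroundField P) →+* HahnSeries ℝ F :=
  MvPolynomial.eval₂Hom (HahnSeries.C.comp (algebraMap (GroundField P) F))
    fun i => HahnSeries.single (a i) (S.x i)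

lemma clusterEval_injective (S : Seed P F n) : Function.Injective S.clusterEval :=
  S.isTranscendenceBasis.1

lemma partialMap_X (S : Seed P F n) (a : Fin n → ℝ) (i : Fin n) :
    PartialMap S.clusterEval (S.toricEval a) (S.x i) (HahnSeries.single (a i) (S.x i)) := by
  simpa [clusterEval, toricEval] using
    PartialMap.of (α := S.clusterEval) (β := S.toricEval a) (MvPolynomial.X i)

lemma partialMap_C (S : Seed P F n) (a : Fin n → ℝ) (c : GroundField P) :
    PartialMap S.clusterEval (S.toricEval a) (algebraMap _ F c)
      (HahnSeries.C (algebraMap _ F c)) := by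
  simpa [clusterEval, toricEval] using
    PartialMap.of (α := S.clusterEval) (β := S.toricEval a) (MvPolynomial.C c)

lemma toricEval_eq_zero (S : Seed P F n) (a : Fin n → ℝ)
    (f : MvPolynomial (Fin n) (GroundField P)) (hf : S.clusterEval f = 0) :
    S.toricEval a f = 0 := by
  rw [(injective_iff_map_eq_zero _).1 S.clusterEval_injective f hf, map_zero]

/-- The seed `T` is toric, with weights `a`, for the monomial valuation on `K(S.x)` with
weights `a₀`. -/
def IsToric (S : Seed P F n) (a₀ : Fin n → ℝ) (T : Seed P F n) (a : Fin n → ℝ) : Prop :=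
  ∃ (w : Fin n → HahnSeries ℝ F) (l : Fin n → F),
    (∀ i, PartialMap S.clusterEval (S.toricEval a₀) (T.x i) (w i)) ∧
    (∀ i, HasLead (w i) (a i) (l i)) ∧ AlgebraicIndependent (GroundField P) l

lemma isToric_self (S : Seed P F n) (a : Fin n → ℝ) : S.IsToric a S a :=
  ⟨fun i => HahnSeries.single (a i) (S.x i), S.x, S.partialMap_X a,
    fun i => HasLead.single (S.x_ne_zero i), S.isTranscendenceBasis.1⟩

lemma IsToric.mutation {S T T' : Seed P F n} {a₀ a : Fin n → ℝ} (h : S.IsToric a₀ T a)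
    {k : Fin n} (hT : IsMutation k T T') :
    S.IsToric a₀ T' (Function.update a k (tropicalBinomial (fun i => T.B i k) a - a k)) := by
  obtain ⟨w, l, hw, hl, hind⟩ := h
  obtain ⟨Q, hQ, hQ0, hQl⟩ := exists_hasLead_binomial (of_ne_zero (T.pPos k))
    (of_ne_zero (T.pNeg k)) (of_add_of_ne_zero _ _) hl hind (fun i => T.B i k) k
    (T.isSignSkewSymmetric.diag k)
  have hβ := PartialMap.binomial
    (S.partialMap_C a₀ (algebraMap _ _ (MonoidAlgebra.of ℤ P (T.pPos k))))
    (S.partialMap_C a₀ (algebraMap _ _ (MonoidAlgebra.of ℤ P (T.pNeg k)))) hw (fun i => T.B i k)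
  rw [← coeffHom_eq, ← coeffHom_eq, ← exchangeElement_eq] at hβ
  rw [← coeffHom_eq, ← coeffHom_eq] at hQl
  refine ⟨Function.update w k (binomial (HahnSeries.C (coeffHom F (T.pPos k)))
      (HahnSeries.C (coeffHom F (T.pNeg k))) w (fun i => T.B i k) / w k),
    Function.update l k (Q / l k), fun i => ?_, fun i => ?_,
    algebraicIndependent_update hind k hQ hQ0 (mul_div_cancel₀ _ (hl k).lead_ne_zero)⟩
  rotate_left
  · by_cases hi : i = k
    · subst hi
      simp only [Function.update_self]
      exact hQl.div (hl i)
    · simp only [Function.update_of_ne hi]; exact hl i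
  · rw [hT.x_eq]
    by_cases hi : i = k
    · subst hi
      rw [Function.update_self, Function.update_self]
      exact PartialMap.div (S.toricEval_eq_zero a₀) hβ (hw i) (hl i).ne_zero
    · simp only [Function.update_of_ne hi]; exact hw i

/-- If a cluster variable has negative weight for a monomial valuation, it does not lie in a
subalgebra generated by elements of non-negative weight. -/
lemma IsToric.notMem_adjoin {S T : Seed P F n} {a₀ a : Fin n → ℝ} (h : S.IsToric a₀ T a)
    {k : Fin n} (hk : a k < 0) {U : Set F}
    (hU : ∀ z ∈ U, ∃ T' a', S.IsToric a₀ T' a' ∧ ∃ i, T'.x i = z ∧ 0 ≤ a' i) :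
    T.x k ∉ Algebra.adjoin (GroundRing P) U := by
  intro hmem
  obtain ⟨w, l, hw, hl, -⟩ := h
  obtain ⟨w', hw', hP⟩ := PartialMap.exists_of_mem_adjoin (W := hahnIntegers F)
    (α := S.clusterEval) (β := S.toricEval a₀)
    (fun r => ⟨_, HahnSeries.orderTop_single_le, by
      rw [IsScalarTower.algebraMap_apply (GroundRing P) (GroundField P) F]
      exact S.partialMap_C a₀ _⟩)
    (fun u hu => by
      obtain ⟨T', a', ⟨w₁, l₁, hw₁, hl₁, -⟩, i, rfl, hi⟩ := hU u hu
      exact ⟨w₁ i, (hl₁ i).mem_hahnIntegers.2 hi, hw₁ i⟩) hmem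
  rw [← (hw k).unique (S.toricEval_eq_zero a₀) hP, (hl k).mem_hahnIntegers] at hw'
  linarith

end Seed

/-- The sign pattern of the oriented cycle `0 → 1 → 2 → 0`. -/
def IsOrientedCycle (B : Matrix (Fin 3) (Fin 3) ℤ) : Prop :=
  (0 < B 0 1 ∧ 0 < B 1 2 ∧ 0 < B 2 0) ∧ B 1 0 < 0 ∧ B 2 1 < 0 ∧ B 0 2 < 0

lemma exists_rank_of_no_cycle : ∀ a b c a' b' c' : Bool, ¬(a && a') → ¬(b && b') → ¬(c && c') →
    ¬(a && b && c) → ¬(a' && b' && c') → ∃ r₀ r₁ r₂ : Fin 3, (a → r₀ < r₁) ∧ (b → r₁ < r₂) ∧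
      (c → r₂ < r₀) ∧ (a' → r₁ < r₀) ∧ (b' → r₂ < r₁) ∧ (c' → r₀ < r₂) := by
  intro a b c a' b' c'
  cases a <;> cases b <;> cases c <;> cases a' <;> cases b' <;> cases c' <;> decide

lemma IsSignSkewSymmetric.neg_iff {n : ℕ} {B : Matrix (Fin n) (Fin n) ℤ}
    (h : IsSignSkewSymmetric B) (i j : Fin n) : 0 < B i j ↔ B j i < 0 := by
  rcases h i j with ⟨h1, h2⟩ | h
  · simp [h1, h2]
  · rcases mul_neg_iff.1 h with h | h
    · exact ⟨fun _ => h.2, fun _ => h.1⟩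
    · exact ⟨fun h' => absurd h' (by omega), fun h' => absurd h' (by omega)⟩

lemma isOrientedCycle_of_not_isAcyclicMatrix {B : Matrix (Fin 3) (Fin 3) ℤ}
    (hB : IsSignSkewSymmetric B) (h : ¬ IsAcyclicMatrix B) :
    IsOrientedCycle B ∨ IsOrientedCycle (-B) := by
  by_contra hcyc
  simp only [IsOrientedCycle, Matrix.neg_apply, not_or] at hcyc
  have h01 := hB.neg_iff 0 1
  have h10 := hB.neg_iff 1 0
  have h12 := hB.neg_iff 1 2
  have h21 := hB.neg_iff 2 1
  have h20 := hB.neg_iff 2 0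
  have h02 := hB.neg_iff 0 2
  obtain ⟨r₀, r₁, r₂, k1, k2, k3, k4, k5, k6⟩ := exists_rank_of_no_cycle
    (decide (0 < B 0 1)) (decide (0 < B 1 2)) (decide (0 < B 2 0))
    (decide (0 < B 1 0)) (decide (0 < B 2 1)) (decide (0 < B 0 2))
    (by simp; omega) (by simp; omega) (by simp; omega) (by simp; omega) (by simp; omega)
  simp only [decide_eq_true_eq] at k1 k2 k3 k4 k5 k6
  apply h
  have hrank : ∀ i j, 0 < B i j → ![r₀, r₁, r₂] i < ![r₀, r₁, r₂] j := by
    intro i j hij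
    have hd := hB.diag
    fin_cases i <;> fin_cases j <;> simp_all
  intro i hi
  have key : ∀ j, Relation.TransGen (fun i j => 0 < B i j) i j →
      ![r₀, r₁, r₂] i < ![r₀, r₁, r₂] j := by
    intro j hj
    induction hj with
    | single h => exact hrank _ _ h
    | tail _ h ih => exact ih.trans (hrank _ _ h)
  exact lt_irrefl _ (key i hi)

lemma IsOrientedCycle.sign_column {B : Matrix (Fin 3) (Fin 3) ℤ} (hB : IsSignSkewSymmetric B)
    (h : IsOrientedCycle B) {i p : Fin 3} (hp : p ≠ i) :
    (∀ j, j ≠ p → B j i ≤ 0) ∨ (∀ j, j ≠ p → 0 ≤ B j i) := by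
  obtain ⟨⟨h1, h2, h3⟩, h4, h5, h6⟩ := h
  have hd := hB.diag
  fin_cases i <;> fin_cases p <;> simp_all [Fin.forall_fin_succ] <;> omega

lemma IsOrientedCycle.pos_of_kernel {B : Matrix (Fin 3) (Fin 3) ℤ} (hB : IsSignSkewSymmetric B)
    (h : IsOrientedCycle B) {d : Fin 3 → ℝ} (hd : ∀ j, ∑ i, d i * B i j = 0) {k : Fin 3}
    (hk : ∀ i, i ≠ k → 0 < d i) : 0 < d k := by
  obtain ⟨⟨h1, h2, h3⟩, h4, h5, h6⟩ := h
  have h1' : (0 : ℝ) < B 0 1 := by exact_mod_cast h1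
  have h2' : (0 : ℝ) < B 1 2 := by exact_mod_cast h2
  have h3' : (0 : ℝ) < B 2 0 := by exact_mod_cast h3
  have h4' : (B 1 0 : ℝ) < 0 := by exact_mod_cast h4
  have h5' : (B 2 1 : ℝ) < 0 := by exact_mod_cast h5
  have h6' : (B 0 2 : ℝ) < 0 := by exact_mod_cast h6
  have e0 := hd 0
  have e1 := hd 1
  have e2 := hd 2
  simp only [Fin.sum_univ_three, hB.diag, Int.cast_zero, mul_zero, zero_add, add_zero] at e0 e1 e2
  fin_cases k
  · have := hk 2 (by decide)
    refine (mul_pos_iff_of_pos_right h1').1 ?_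
    show 0 < d 0 * (B 0 1 : ℝ)
    linarith [mul_pos this (neg_pos.2 h5')]
  · have := hk 0 (by decide)
    refine (mul_pos_iff_of_pos_right h2').1 ?_
    show 0 < d 1 * (B 1 2 : ℝ)
    linarith [mul_pos this (neg_pos.2 h6')]
  · have := hk 1 (by decide)
    refine (mul_pos_iff_of_pos_right h3').1 ?_
    show 0 < d 2 * (B 2 0 : ℝ)
    linarith [mul_pos this (neg_pos.2 h4')]

lemma IsOrientedCycle.exists_kernel {B : Matrix (Fin 3) (Fin 3) ℤ}
    (hB : IsSignSkewSymmetric B) (hS : IsSkewSymmetrizable B) (h : IsOrientedCycle B) :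
    ∃ d : Fin 3 → ℝ, (∀ i, 0 < d i) ∧ ∀ j, ∑ i, d i * B i j = 0 := by
  obtain ⟨⟨h1, h2, h3⟩, h4, h5, h6⟩ := h
  obtain ⟨δ, hδ, hB'⟩ := hS
  have h1' : (0 : ℝ) < B 0 1 := by exact_mod_cast h1
  have h2' : (0 : ℝ) < B 1 2 := by exact_mod_cast h2
  have h3' : (0 : ℝ) < B 2 0 := by exact_mod_cast h3
  have d0 := hδ 0
  have d1 := hδ 1
  have d2 := hδ 2
  refine ⟨![δ 0 * (δ 1 * B 1 2), δ 1 * (δ 2 * B 2 0), δ 2 * (δ 0 * B 0 1)], ?_, ?_⟩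
  · intro i
    fin_cases i <;> simp <;> positivity
  · have e01 := hB' 0 1
    have e12 := hB' 1 2
    have e20 := hB' 2 0
    have hd := hB.diag
    intro j
    fin_cases j <;> simp [Fin.sum_univ_three, hd]
    · linear_combination δ 2 * (B 2 0 : ℝ) * e01
    · linear_combination δ 0 * (B 0 1 : ℝ) * e12
    · linear_combination δ 1 * (B 1 2 : ℝ) * e20

lemma isSignSkewSymmetric_neg {n : ℕ} {B : Matrix (Fin n) (Fin n) ℤ}
    (h : IsSignSkewSymmetric B) : IsSignSkewSymmetric (-B) := by
  intro i j
  simpa using h i j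

lemma IsSkewSymmetrizable.neg {n : ℕ} {B : Matrix (Fin n) (Fin n) ℤ}
    (h : IsSkewSymmetrizable B) : IsSkewSymmetrizable (-B) := by
  obtain ⟨d, hd, h⟩ := h
  refine ⟨d, hd, fun i j => ?_⟩
  have := h i j
  simp only [Matrix.neg_apply, Int.cast_neg]
  linarith

section NotAcyclic

variable {B : Matrix (Fin 3) (Fin 3) ℤ} (hB : IsSignSkewSymmetric B) (h : ¬ IsAcyclicMatrix B)

include hB h

lemma sign_column_of_not_isAcyclicMatrix {i p : Fin 3} (hp : p ≠ i) :
    (∀ j, j ≠ p → B j i ≤ 0) ∨ (∀ j, j ≠ p → 0 ≤ B j i) := by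
  rcases isOrientedCycle_of_not_isAcyclicMatrix hB h with h | h
  · exact h.sign_column hB hp
  · have := h.sign_column (isSignSkewSymmetric_neg hB) hp
    simp only [Matrix.neg_apply] at this
    rcases this with h | h
    · exact Or.inr fun j hj => by linarith [h j hj]
    · exact Or.inl fun j hj => by linarith [h j hj]

lemma pos_of_kernel_of_not_isAcyclicMatrix {d : Fin 3 → ℝ} (hd : ∀ j, ∑ i, d i * B i j = 0)
    {k : Fin 3} (hk : ∀ i, i ≠ k → 0 < d i) : 0 < d k := by
  rcases isOrientedCycle_of_not_isAcyclicMatrix hB h with h | h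
  · exact h.pos_of_kernel hB hd hk
  · refine h.pos_of_kernel (isSignSkewSymmetric_neg hB) (fun j => ?_) hk
    simp [hd j]

lemma exists_kernel_of_not_isAcyclicMatrix (hS : IsSkewSymmetrizable B) :
    ∃ d : Fin 3 → ℝ, (∀ i, 0 < d i) ∧ ∀ j, ∑ i, d i * B i j = 0 := by
  rcases isOrientedCycle_of_not_isAcyclicMatrix hB h with h | h
  · exact h.exists_kernel hB hS
  · obtain ⟨d, hd, h⟩ := h.exists_kernel (isSignSkewSymmetric_neg hB) hS.neg
    exact ⟨d, hd, fun j => by simpa using h j⟩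

end NotAcyclic

lemma toNat_sub_toNat_neg_real (b : ℤ) : ((b.toNat : ℝ) - ((-b).toNat : ℝ)) = b := by
  have : ((b.toNat : ℤ) - ((-b).toNat : ℤ)) = b := Int.toNat_sub_toNat_neg b
  exact_mod_cast this

/-- For a vector in the left kernel of `B`, both terms of the tropical exchange agree. -/
lemma sum_toNat_eq_of_kernel {n : ℕ} {b : Fin n → ℤ} {d : Fin n → ℝ} (hd : ∑ i, d i * b i = 0) :
    ∑ i, ((-b i).toNat : ℝ) * d i = ∑ i, ((b i).toNat : ℝ) * d i := by
  have : ∑ i, d i * b i = ∑ i, ((b i).toNat : ℝ) * d i - ∑ i, ((-b i).toNat : ℝ) * d i := by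
    rw [← Finset.sum_sub_distrib]
    refine Finset.sum_congr rfl fun i _ => ?_
    rw [← toNat_sub_toNat_neg_real (b i)]; ring
  linarith

lemma tropicalBinomial_sub_smul {n : ℕ} {b : Fin n → ℤ} {d : Fin n → ℝ}
    (hd : ∑ i, d i * b i = 0) (v : Fin n → ℝ) (μ : ℝ) :
    tropicalBinomial b (v - μ • d) =
      tropicalBinomial b v - μ * ∑ i, ((b i).toNat : ℝ) * d i := by
  have key : ∀ m : Fin n → ℝ, ∑ i, m i * (v - μ • d) i = ∑ i, m i * v i - μ * ∑ i, m i * d i := by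
    intro m
    rw [Finset.mul_sum, ← Finset.sum_sub_distrib]
    refine Finset.sum_congr rfl fun i _ => ?_
    simp only [Pi.sub_apply, Pi.smul_apply, smul_eq_mul]; ring
  unfold tropicalBinomial
  rw [key, key, sum_toNat_eq_of_kernel hd, min_sub_sub_right]

lemma kernel_matrixMutation {n : ℕ} {B : Matrix (Fin n) (Fin n) ℤ} {d : Fin n → ℝ}
    (hB : IsSignSkewSymmetric B) (hd : ∀ j, ∑ i, d i * B i j = 0) (k j : Fin n) :
    ∑ i, Function.update d k (∑ i, ((B i k).toNat : ℝ) * d i - d k) i *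
      (matrixMutation k B i j : ℝ) = 0 := by
  set D := ∑ i, ((B i k).toNat : ℝ) * d i with hD
  have hD' : ∑ i, ((-B i k).toNat : ℝ) * d i = D := sum_toNat_eq_of_kernel (hd k)
  rw [← Finset.add_sum_erase _ _ (Finset.mem_univ k), Function.update_self, matrixMutation_left]
  have hcongr : ∀ i ∈ Finset.univ.erase k,
      Function.update d k (D - d k) i * (matrixMutation k B i j : ℝ) =
        d i * (matrixMutation k B i j : ℝ) := by
    intro i hi
    rw [Function.update_of_ne (Finset.ne_of_mem_erase hi)]
  rw [Finset.sum_congr rfl hcongr]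
  by_cases hj : j = k
  · subst hj
    rw [hB.diag]
    have : ∀ i ∈ Finset.univ.erase j, d i * (matrixMutation j B i j : ℝ) = -(d i * (B i j : ℝ)) := by
      intro i _
      rw [matrixMutation_right]; push_cast; ring
    rw [Finset.sum_congr rfl this, Finset.sum_neg_distrib]
    have := hd j
    rw [← Finset.add_sum_erase _ _ (Finset.mem_univ j), hB.diag] at this
    simp only [Int.cast_zero, mul_zero, zero_add] at this
    simp [this]
  · have hmax : ∀ b : ℤ, ((max b 0 : ℤ) : ℝ) = (b.toNat : ℝ) := by
      intro b
      rw [← Int.toNat_eq_max, Int.cast_natCast]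
    have : ∀ i ∈ Finset.univ.erase k, d i * (matrixMutation k B i j : ℝ) =
        d i * (B i j : ℝ) + (((B k j).toNat : ℝ) * (((B i k).toNat : ℝ) * d i) -
          ((-B k j).toNat : ℝ) * (((-B i k).toNat : ℝ) * d i)) := by
      intro i hi
      rw [matrixMutation_of_ne _ _ (Finset.ne_of_mem_erase hi) hj]
      simp only [Int.cast_add, Int.cast_sub, Int.cast_mul, hmax]; ring
    rw [Finset.sum_congr rfl this, Finset.sum_add_distrib, Finset.sum_sub_distrib,
      ← Finset.mul_sum, ← Finset.mul_sum]
    have e0 := hd j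
    rw [← Finset.add_sum_erase _ _ (Finset.mem_univ k)] at e0
    have e1 := hD
    rw [← Finset.add_sum_erase _ _ (Finset.mem_univ k), hB.diag] at e1
    have e2 := hD'
    rw [← Finset.add_sum_erase _ _ (Finset.mem_univ k), hB.diag] at e2
    simp only [Int.toNat_zero, neg_zero, Nat.cast_zero, zero_mul, zero_add] at e1 e2
    rw [← e1, e2]
    push_cast
    linear_combination e0 + D * toNat_sub_toNat_neg_real (B k j)

namespace Seed

variable {P : Type u} [CommGroup P] [IsMulTorsionFree P]
  {F : Type v} [Field F] [Algebra (GroundField P) F] [Algebra (GroundRing P) F]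
  [IsScalarTower (GroundRing P) (GroundField P) F]

/-- A pair of non-proportional tropical points `v`, `d` of `T`, with `d` positive and in the left
kernel of the exchange matrix, such that `v - μ d` is a toric weight for every `μ`. -/
structure IsWeightPair {n : ℕ} (S : Seed P F n) (v₀ d₀ : Fin n → ℝ) (T : Seed P F n)
    (v d : Fin n → ℝ) : Prop where
  pos : ∀ i, 0 < d i
  kernel : ∀ j, ∑ i, d i * T.B i j = 0
  not_proportional : ¬ ∃ m : ℝ, v = m • d
  isToric : ∀ μ : ℝ, S.IsToric (v₀ - μ • d₀) T (v - μ • d)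

lemma IsWeightPair.mutation {S T T' : Seed P F 3} {v₀ d₀ v d : Fin 3 → ℝ}
    (h : S.IsWeightPair v₀ d₀ T v d) {k : Fin 3} (hT : IsMutation k T T') (hT' : ¬ T'.IsAcyclic) :
    S.IsWeightPair v₀ d₀ T'
      (Function.update v k (tropicalBinomial (fun i => T.B i k) v - v k))
      (Function.update d k (∑ i, ((T.B i k).toNat : ℝ) * d i - d k)) := by
  have hker : ∀ j, ∑ i, Function.update d k (∑ i, ((T.B i k).toNat : ℝ) * d i - d k) i *
      (T'.B i j : ℝ) = 0 := by
    rw [hT.matrix_eq]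
    exact kernel_matrixMutation T.isSignSkewSymmetric h.kernel k
  refine ⟨fun i => ?_, hker, ?_, fun μ => ?_⟩
  · by_cases hi : i = k
    · subst hi
      refine pos_of_kernel_of_not_isAcyclicMatrix T'.isSignSkewSymmetric hT' hker fun j hj => ?_
      rw [Function.update_of_ne hj]; exact h.pos j
    · rw [Function.update_of_ne hi]; exact h.pos i
  · rintro ⟨m, hm⟩
    apply h.not_proportional
    refine ⟨m, funext fun i => ?_⟩
    have hne : ∀ j, j ≠ k → v j = m * d j := by
      intro j hj
      have := congrFun hm j
      simpa [Function.update_of_ne hj] using this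
    by_cases hi : i = k
    · subst hi
      have h1 := congrFun hm i
      simp only [Function.update_self, Pi.smul_apply, smul_eq_mul] at h1
      have h2 : ∀ c : Fin 3 → ℤ, c i = 0 →
          ∑ j, ((c j).toNat : ℝ) * v j = m * ∑ j, ((c j).toNat : ℝ) * d j := by
        intro c hc
        rw [Finset.mul_sum]
        refine Finset.sum_congr rfl fun j _ => ?_
        by_cases hj : j = i
        · subst hj; simp [hc]
        · rw [hne j hj]; ring
      have h0 := T.isSignSkewSymmetric.diag i
      have h3 : tropicalBinomial (fun j => T.B j i) v =
          m * ∑ j, ((T.B j i).toNat : ℝ) * d j := by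
        unfold tropicalBinomial
        rw [h2 (fun j => T.B j i) h0, h2 (fun j => -T.B j i) (by simp [h0]),
          sum_toNat_eq_of_kernel (h.kernel i), min_self]
      rw [h3] at h1
      simp only [Pi.smul_apply, smul_eq_mul]
      linarith
    · exact hne i hi
  · convert (h.isToric μ).mutation hT using 1
    rw [tropicalBinomial_sub_smul (h.kernel k)]
    ext i
    by_cases hi : i = k
    · subst hi
      simp only [Pi.sub_apply, Pi.smul_apply, smul_eq_mul, Function.update_self]; ring
    · simp [Function.update_of_ne hi]

/-- Among three ratios `v i / d i` that are not all equal, one exchange strictly decreases the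
minimum. -/
lemma IsWeightPair.exists_lt {S T : Seed P F 3} {v₀ d₀ v d : Fin 3 → ℝ}
    (h : S.IsWeightPair v₀ d₀ T v d) (hT : ¬ T.IsAcyclic) {μ : ℝ} {q : Fin 3}
    (hq : v q ≤ μ * d q) : ∃ k, ∀ e : ℝ, e = ∑ i, ((T.B i k).toNat : ℝ) * d i - d k → 0 < e →
      tropicalBinomial (fun i => T.B i k) v - v k < μ * e := by
  obtain ⟨p, -, hp⟩ := Finset.exists_min_image Finset.univ (fun i => v i / d i) ⟨0, Finset.mem_univ _⟩
  set m := v p / d p with hm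
  have hpm : v p = m * d p := by rw [hm, div_mul_cancel₀ _ (h.pos p).ne']
  have hle : ∀ i, m * d i ≤ v i := by
    intro i
    exact (le_div_iff₀ (h.pos i)).1 (hp i (Finset.mem_univ i))
  have hmμ : m ≤ μ := by
    have := (hle q).trans hq
    exact le_of_mul_le_mul_right this (h.pos q)
  obtain ⟨k, hk⟩ : ∃ k, m * d k < v k := by
    by_contra hcon
    push Not at hcon
    exact h.not_proportional ⟨m, funext fun i => le_antisymm (hcon i) (hle i)⟩
  have hpk : p ≠ k := by
    rintro rfl
    exact hk.ne hpm.symm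
  refine ⟨k, fun e he he0 => ?_⟩
  have hsum : ∀ c : Fin 3 → ℤ, (∀ j, j ≠ p → c j ≤ 0) →
      ∑ j, ((c j).toNat : ℝ) * v j = m * ∑ j, ((c j).toNat : ℝ) * d j := by
    intro c hc
    rw [Finset.mul_sum]
    refine Finset.sum_congr rfl fun j _ => ?_
    by_cases hj : j = p
    · subst hj; rw [hpm]; ring
    · rw [Int.toNat_of_nonpos (hc j hj)]; simp
  have htrop : tropicalBinomial (fun i => T.B i k) v ≤
      m * ∑ i, ((T.B i k).toNat : ℝ) * d i := by
    rcases sign_column_of_not_isAcyclicMatrix T.isSignSkewSymmetric hT hpk with hs | hs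
    · rw [← hsum _ hs]; exact min_le_left _ _
    · rw [← sum_toNat_eq_of_kernel (h.kernel k), ← hsum (fun j => -T.B j k)
        (fun j hj => by simpa using hs j hj)]
      exact min_le_right _ _
  calc _ < m * ∑ i, ((T.B i k).toNat : ℝ) * d i - m * d k := by linarith
    _ = m * e := by rw [he]; ring
    _ ≤ μ * e := by nlinarith

lemma exists_isWeightPair {S : Seed P F 3} (hS : IsSkewSymmetrizable S.B)
    (hac : ∀ T, S.MutationEquivalent T → ¬ T.IsAcyclic) :
    ∃ v₀ d₀, ∀ T, S.MutationEquivalent T → ∃ v d, S.IsWeightPair v₀ d₀ T v d := by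
  obtain ⟨d₀, hd₀, hker⟩ := exists_kernel_of_not_isAcyclicMatrix S.isSignSkewSymmetric
    (hac S (Relation.EqvGen.refl _)) hS
  refine ⟨![1, 0, 0], d₀, fun T hT => ?_⟩
  refine hT.induction (motive := fun T => ∃ v d, S.IsWeightPair ![1, 0, 0] d₀ T v d)
    ⟨![1, 0, 0], d₀, hd₀, hker, ?_, fun μ => S.isToric_self _⟩ ?_
  · rintro ⟨m, hm⟩
    have h0 := congrFun hm 0
    have h1 := congrFun hm 1
    simp only [Matrix.cons_val_zero, Matrix.cons_val_one, Pi.smul_apply, smul_eq_mul] at h0 h1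
    rcases mul_eq_zero.1 h1.symm with h | h
    · rw [h, zero_mul] at h0; exact one_ne_zero h0
    · exact (hd₀ 1).ne' h
  · rintro T T' k hT hTT' ⟨v, d, h⟩
    exact ⟨_, _, h.mutation hTT' (hac T' (hT.trans hTT'.mutationEquivalent))⟩

end Seed

lemma exists_finset_subset_of_mem_adjoin {R A : Type*} [CommRing R] [CommRing A] [Algebra R A]
    {s : Set A} {x : A} (hx : x ∈ Algebra.adjoin R s) :
    ∃ t : Finset A, (t : Set A) ⊆ s ∧ x ∈ Algebra.adjoin R (t : Set A) := by
  classical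
  induction hx using Algebra.adjoin_induction with
  | mem x hx => exact ⟨{x}, by simpa using hx, Algebra.subset_adjoin (by simp)⟩
  | algebraMap r => exact ⟨∅, by simp, Subalgebra.algebraMap_mem _ r⟩
  | add x y _ _ hx hy =>
    obtain ⟨t, ht, hxt⟩ := hx
    obtain ⟨t', ht', hyt⟩ := hy
    refine ⟨t ∪ t', by simp [ht, ht'], add_mem ?_ ?_⟩
    · exact Algebra.adjoin_mono (by simp) hxt
    · exact Algebra.adjoin_mono (by simp) hyt
  | mul x y _ _ hx hy =>
    obtain ⟨t, ht, hxt⟩ := hx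
    obtain ⟨t', ht', hyt⟩ := hy
    refine ⟨t ∪ t', by simp [ht, ht'], mul_mem ?_ ?_⟩
    · exact Algebra.adjoin_mono (by simp) hxt
    · exact Algebra.adjoin_mono (by simp) hyt

/-- A finitely generated algebra is generated by a finite subset of any generating set. -/
lemma exists_finset_adjoin_eq_of_fg {R A : Type*} [CommRing R] [CommRing A] [Algebra R A]
    {s : Set A} (h : (Algebra.adjoin R s).FG) :
    ∃ t : Finset A, (t : Set A) ⊆ s ∧ Algebra.adjoin R (t : Set A) = Algebra.adjoin R s := by
  classical
  obtain ⟨g, hg⟩ := h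
  have : ∀ x : g, ∃ t : Finset A, (t : Set A) ⊆ s ∧ (x : A) ∈ Algebra.adjoin R (t : Set A) :=
    fun x => exists_finset_subset_of_mem_adjoin (hg ▸ Algebra.subset_adjoin x.2)
  choose t ht hxt using this
  refine ⟨Finset.univ.biUnion t, by simpa using ht, le_antisymm (Algebra.adjoin_mono (by simpa using ht)) ?_⟩
  rw [← hg]
  refine Algebra.adjoin_le fun x hx => ?_
  refine Algebra.adjoin_mono ?_ (hxt ⟨x, hx⟩)
  exact_mod_cast Finset.subset_biUnion_of_mem t (Finset.mem_univ (⟨x, hx⟩ : g))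

namespace Seed

variable {P : Type u} [CommGroup P] [IsMulTorsionFree P]
  {F : Type v} [Field F] [Algebra (GroundField P) F] [Algebra (GroundRing P) F]
  [IsScalarTower (GroundRing P) (GroundField P) F]

/-- A rank 3 cluster algebra without acyclic seeds is not finitely generated. -/
theorem exists_isAcyclic_of_fg {S : Seed P F 3} (hS : IsSkewSymmetrizable S.B)
    (hfg : S.clusterAlgebra.FG) : ∃ T, S.MutationEquivalent T ∧ T.IsAcyclic := by
  classical
  by_contra hcon
  push Not at hcon
  obtain ⟨v₀, d₀, hw⟩ := exists_isWeightPair hS hcon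
  obtain ⟨t, hts, ht⟩ := exists_finset_adjoin_eq_of_fg hfg
  have hts' : ∀ z : F, z ∈ insert (S.x 0) t → ∃ (T : Seed P F 3) (v d : Fin 3 → ℝ) (i : Fin 3),
      S.MutationEquivalent T ∧ T.x i = z ∧ S.IsWeightPair v₀ d₀ T v d := by
    intro z hz
    obtain ⟨T, hT, i, hi⟩ : ∃ T, S.MutationEquivalent T ∧ ∃ i, T.x i = z := by
      rcases Finset.mem_insert.1 hz with rfl | hz
      · exact ⟨S, Relation.EqvGen.refl _, 0, rfl⟩
      · exact hts hz
    obtain ⟨v, d, h⟩ := hw T hT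
    exact ⟨T, v, d, i, hT, hi, h⟩
  have : Nonempty (Seed P F 3) := ⟨S⟩
  choose! T v d i hT hi hTw using hts'
  obtain ⟨z, hz, hmin⟩ := Finset.exists_min_image (insert (S.x 0) t)
    (fun z => v z (i z) / d z (i z)) (Finset.insert_nonempty _ _)
  set μ := v z (i z) / d z (i z) with hμ
  obtain ⟨k, hk⟩ := (hTw z hz).exists_lt (hcon _ (hT z hz)) (μ := μ) (q := i z)
    (by rw [hμ, div_mul_cancel₀ _ ((hTw z hz).pos _).ne'])
  obtain ⟨T', hT'⟩ := (T z).exists_isMutation_of_isSkewSymmetrizable k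
    ((hT z hz).isSkewSymmetrizable hS)
  have hST' := (hT z hz).trans hT'.mutationEquivalent
  have hpair := (hTw z hz).mutation hT' (hcon T' hST')
  have hneg := hk _ rfl (by simpa using hpair.pos k)
  refine (hpair.isToric μ).notMem_adjoin (k := k) (U := t) ?_ ?_ ?_
  · simp only [Pi.sub_apply, Pi.smul_apply, smul_eq_mul, Function.update_self]
    linarith
  · intro y hy
    have hy' : y ∈ insert (S.x 0) t := Finset.mem_insert_of_mem hy
    refine ⟨T y, _, (hTw y hy').isToric μ, i y, hi y hy', ?_⟩
    have := (le_div_iff₀ ((hTw y hy').pos (i y))).1 (hmin y hy')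
    simp only [Pi.sub_apply, Pi.smul_apply, smul_eq_mul]
    linarith
  · rw [ht]
    exact Algebra.subset_adjoin ⟨T', hST', k, rfl⟩

end Seed

lemma binomial_swap {E : Type*} [CommSemiring E] {n : ℕ} (c c' : E) (x : Fin n → E)
    (b : Fin n → ℤ) : binomial c' c x (-b) = binomial c c' x b := by
  simp [binomial, add_comm]

lemma matrixMutation_neg {n : ℕ} (B : Matrix (Fin n) (Fin n) ℤ) (k : Fin n) :
    matrixMutation k (-B) = -matrixMutation k B := by
  ext i j
  by_cases hi : i = k
  · subst hi; simp [matrixMutation_left]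
  by_cases hj : j = k
  · subst hj; simp [matrixMutation_right]
  rw [Matrix.neg_apply, matrixMutation_of_ne _ _ hi hj, matrixMutation_of_ne _ _ hi hj]
  simp only [Matrix.neg_apply, neg_neg]
  ring

namespace Seed

variable {P : Type u} [CommGroup P] [IsMulTorsionFree P]
  {F : Type v} [Field F] [Algebra (GroundField P) F] [Algebra (GroundRing P) F] {n : ℕ}
  [IsScalarTower (GroundRing P) (GroundField P) F]

/-- The opposite seed. -/
def opp (S : Seed P F n) : Seed P F n where
  x := S.x
  isTranscendenceBasis := S.isTranscendenceBasis
  pPos := S.pNeg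
  pNeg := S.pPos
  B := -S.B
  isSignSkewSymmetric := isSignSkewSymmetric_neg S.isSignSkewSymmetric

lemma opp_exchangeElement (S : Seed P F n) (k : Fin n) :
    S.opp.exchangeElement k = S.exchangeElement k := by
  rw [exchangeElement_eq, exchangeElement_eq]
  exact binomial_swap _ _ _ _

lemma opp_x' (S : Seed P F n) (k : Fin n) : S.opp.x' k = S.x' k := by
  rw [x', x', opp_exchangeElement]; rfl

lemma IsMutation.opp {S S' : Seed P F n} {k : Fin n} (h : IsMutation k S S') :
    IsMutation k S.opp S'.opp where
  x_of_ne := h.x_of_ne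
  exchange := by rw [opp_exchangeElement]; exact h.exchange
  pPos_self := h.pNeg_self
  pNeg_self := h.pPos_self
  ratio_of_nonneg i hi hb := by
    have hb' : S.B k i ≤ 0 := by simpa [Seed.opp] using hb
    have := h.ratio_of_nonpos i hi hb'
    simp only [Seed.opp, Matrix.neg_apply]
    rw [← inv_div (S'.pPos i), this, ← inv_div (S.pPos i), zpow_neg, mul_inv]
  ratio_of_nonpos i hi hb := by
    have hb' : 0 ≤ S.B k i := by simpa [Seed.opp] using hb
    have := h.ratio_of_nonneg i hi hb'
    simp only [Seed.opp, Matrix.neg_apply]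
    rw [← inv_div (S'.pPos i), this, ← inv_div (S.pPos i), zpow_neg, mul_inv]
  matrix_eq := by
    simp only [Seed.opp, h.matrix_eq, matrixMutation_neg]

/-- The subalgebra generated by the cluster, the exchanged variables in directions `s`, and the
inverses of the cluster variables in the other directions. It interpolates between the Laurent
ring (`s = ∅`) and the lower bound (`s = univ`). -/
noncomputable def bound (S : Seed P F n) (s : Set (Fin n)) : Subalgebra (GroundRing P) F :=
  Algebra.adjoin (GroundRing P) (Set.range S.x ∪ S.x' '' s ∪ (fun i => (S.x i)⁻¹) '' sᶜ)

variable (S : Seed P F n) {s t : Set (Fin n)}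

lemma x_mem_bound (i : Fin n) : S.x i ∈ S.bound s :=
  Algebra.subset_adjoin (Or.inl (Or.inl ⟨i, rfl⟩))

lemma inv_mem_bound {i : Fin n} (hi : i ∉ s) : (S.x i)⁻¹ ∈ S.bound s :=
  Algebra.subset_adjoin (Or.inr ⟨i, hi, rfl⟩)

lemma coeffHom_mem (W : Subalgebra (GroundRing P) F) (p : P) : coeffHom F p ∈ W :=
  W.algebraMap_mem _

lemma coeffHom_inv_mem (W : Subalgebra (GroundRing P) F) (p : P) : (coeffHom F p)⁻¹ ∈ W := by
  rw [← map_inv]; exact coeffHom_mem W _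

lemma prod_mem_bound (m : Fin n → ℕ) (u : Finset (Fin n)) : ∏ i ∈ u, S.x i ^ m i ∈ S.bound s :=
  prod_mem fun i _ => pow_mem (S.x_mem_bound i) _

lemma prod_inv_mem_bound {m : Fin n → ℕ} (hm : ∀ i ∈ s, m i = 0) (u : Finset (Fin n)) :
    (∏ i ∈ u, S.x i ^ m i)⁻¹ ∈ S.bound s := by
  rw [← Finset.prod_inv_distrib]
  refine prod_mem fun i _ => ?_
  by_cases hi : i ∈ s
  · simp [hm i hi]
  · rw [← inv_pow]; exact pow_mem (S.inv_mem_bound hi) _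

lemma zpow_mem_bound {i : Fin n} {m : ℤ} (hm : i ∈ s → m = 0) : S.x i ^ m ∈ S.bound s := by
  by_cases hi : i ∈ s
  · simp [hm hi]
  · obtain ⟨k, rfl | rfl⟩ := m.eq_nat_or_neg
    · rw [zpow_natCast]; exact pow_mem (S.x_mem_bound i) _
    · rw [zpow_neg, zpow_natCast, ← inv_pow]; exact pow_mem (S.inv_mem_bound hi) _

lemma exchangeElement_mem_bound (i : Fin n) : S.exchangeElement i ∈ S.bound s := by
  rw [exchangeElement_eq]
  exact add_mem (mul_mem (coeffHom_mem _ _) (S.prod_mem_bound _ _))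
    (mul_mem (coeffHom_mem _ _) (S.prod_mem_bound _ _))

lemma x'_mem_bound (i : Fin n) : S.x' i ∈ S.bound s := by
  by_cases hi : i ∈ s
  · exact Algebra.subset_adjoin (Or.inl (Or.inr ⟨i, hi, rfl⟩))
  · rw [x', div_eq_mul_inv]
    exact mul_mem (S.exchangeElement_mem_bound i) (S.inv_mem_bound hi)

lemma bound_le {W : Subalgebra (GroundRing P) F} (h1 : ∀ i, S.x i ∈ W) (h2 : ∀ i ∈ s, S.x' i ∈ W)
    (h3 : ∀ i, i ∉ s → (S.x i)⁻¹ ∈ W) : S.bound s ≤ W := by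
  refine Algebra.adjoin_le ?_
  rintro _ ((⟨i, rfl⟩ | ⟨i, hi, rfl⟩) | ⟨i, hi, rfl⟩)
  exacts [h1 i, h2 i hi, h3 i hi]

lemma bound_mono (h : t ⊆ s) : S.bound s ≤ S.bound t :=
  S.bound_le (fun i => S.x_mem_bound i) (fun i _ => S.x'_mem_bound i)
    fun _ hi => S.inv_mem_bound fun hi' => hi (h hi')

lemma opp_bound : S.opp.bound s = S.bound s := by
  have : S.opp.x' = S.x' := funext S.opp_x'
  simp only [bound, this]; rfl

lemma exists_pow_mul_mem_bound {j : Fin n} (hst : ∀ l ∈ s, l ≠ j → l ∈ t) {f : F}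
    (hf : f ∈ S.bound t) : ∃ a : ℕ, S.x j ^ a * f ∈ S.bound s := by
  have hx := S.x_mem_bound (s := s) j
  induction hf using Algebra.adjoin_induction with
  | mem f hf =>
    rcases hf with ((⟨i, rfl⟩ | ⟨i, hi, rfl⟩) | ⟨i, hi, rfl⟩)
    · exact ⟨0, by simpa using S.x_mem_bound i⟩
    · exact ⟨0, by simpa using S.x'_mem_bound i⟩
    · by_cases his : i ∈ s
      · have hij : i = j := by
          by_contra hij
          exact hi (hst i his hij)
        subst hij
        exact ⟨1, by simp [mul_inv_cancel₀ (S.x_ne_zero i)]⟩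
      · exact ⟨0, by simpa using S.inv_mem_bound his⟩
  | algebraMap r => exact ⟨0, by simp⟩
  | add f g _ _ hf hg =>
    obtain ⟨a, ha⟩ := hf
    obtain ⟨b, hb⟩ := hg
    refine ⟨a + b, ?_⟩
    rw [show S.x j ^ (a + b) * (f + g) =
      S.x j ^ b * (S.x j ^ a * f) + S.x j ^ a * (S.x j ^ b * g) by ring]
    exact add_mem (mul_mem (pow_mem hx _) ha) (mul_mem (pow_mem hx _) hb)
  | mul f g _ _ hf hg =>
    obtain ⟨a, ha⟩ := hf
    obtain ⟨b, hb⟩ := hg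
    refine ⟨a + b, ?_⟩
    rw [show S.x j ^ (a + b) * (f * g) = (S.x j ^ a * f) * (S.x j ^ b * g) by ring]
    exact mul_mem ha hb

/-- If `x j` divides exactly one of the two terms of the exchange element in direction `i`, and the
other term is a unit of `bound s`, then the exchange element is a unit plus a multiple of `x j`. -/
lemma exchangeElement_split_of_pos {i j : Fin n} (hj : 0 < S.B j i) (hs : ∀ l ∈ s, 0 ≤ S.B l i) :
    (coeffHom F (S.pNeg i) * ∏ l, S.x l ^ (-S.B l i).toNat)⁻¹ ∈ S.bound s ∧
    ∃ w ∈ S.bound s, S.exchangeElement i =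
      coeffHom F (S.pNeg i) * ∏ l, S.x l ^ (-S.B l i).toNat + S.x j * w := by
  refine ⟨?_, coeffHom F (S.pPos i) *
    (S.x j ^ ((S.B j i).toNat - 1) * ∏ l ∈ Finset.univ.erase j, S.x l ^ (S.B l i).toNat), ?_, ?_⟩
  · rw [mul_inv]
    exact mul_mem (coeffHom_inv_mem _ _) (S.prod_inv_mem_bound
      (fun l hl => Int.toNat_of_nonpos (by simpa using hs l hl)) _)
  · exact mul_mem (coeffHom_mem _ _) (mul_mem (pow_mem (S.x_mem_bound j) _) (S.prod_mem_bound _ _))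
  · rw [exchangeElement_eq, binomial, add_comm,
      ← Finset.mul_prod_erase _ (fun l => S.x l ^ (S.B l i).toNat) (Finset.mem_univ j)]
    congr 1
    have : (S.B j i).toNat = (S.B j i).toNat - 1 + 1 := by omega
    rw [show S.x j ^ (S.B j i).toNat = S.x j ^ ((S.B j i).toNat - 1) * S.x j by
      rw [← pow_succ, ← this]]
    ring

lemma exists_exchangeElement_split {i j : Fin n}
    (h : (0 < S.B j i ∧ ∀ l ∈ s, 0 ≤ S.B l i) ∨ (S.B j i < 0 ∧ ∀ l ∈ s, S.B l i ≤ 0)) :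
    ∃ A, A ≠ 0 ∧ A⁻¹ ∈ S.bound s ∧ ∃ w ∈ S.bound s, S.exchangeElement i = A + S.x j * w := by
  have hne : ∀ p : P, ∀ m : Fin n → ℕ, coeffHom F p * ∏ l, S.x l ^ m l ≠ 0 := fun p m =>
    mul_ne_zero (coeffHom_ne_zero _)
      (Finset.prod_ne_zero_iff.2 fun l _ => pow_ne_zero _ (S.x_ne_zero l))
  rcases h with ⟨hj, hs⟩ | ⟨hj, hs⟩
  · exact ⟨_, hne _ _, S.exchangeElement_split_of_pos hj hs⟩
  · have := S.opp.exchangeElement_split_of_pos (s := s) (i := i) (j := j)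
      (by simpa [Seed.opp] using hj) (fun l hl => by simpa [Seed.opp] using hs l hl)
    rw [opp_bound, opp_exchangeElement] at this
    exact ⟨_, hne _ _, this⟩

/-- The gluing principle: if `x i` and `x j` generate the unit ideal of `bound s`, then elements
that become integral after inverting `x i`, and after inverting `x j`, lie in `bound s`. -/
lemma mem_bound_of_mem_of_mem {i j : Fin n}
    (h : (0 < S.B j i ∧ ∀ l ∈ s, 0 ≤ S.B l i) ∨ (S.B j i < 0 ∧ ∀ l ∈ s, S.B l i ≤ 0))
    {t₁ t₂ : Set (Fin n)} (h₁ : ∀ l ∈ s, l ≠ i → l ∈ t₁) (h₂ : ∀ l ∈ s, l ≠ j → l ∈ t₂) {f : F}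
    (hf₁ : f ∈ S.bound t₁) (hf₂ : f ∈ S.bound t₂) : f ∈ S.bound s := by
  obtain ⟨A, hA0, hA, w, hw, hE⟩ := S.exists_exchangeElement_split h
  obtain ⟨a, ha⟩ := S.exists_pow_mul_mem_bound h₁ hf₁
  obtain ⟨b, hb⟩ := S.exists_pow_mul_mem_bound h₂ hf₂
  have hcop : IsCoprime (⟨S.x i, S.x_mem_bound i⟩ : S.bound s) ⟨S.x j, S.x_mem_bound j⟩ := by
    refine ⟨⟨_, mul_mem hA (S.x'_mem_bound i)⟩, ⟨_, neg_mem (mul_mem hA hw)⟩, Subtype.ext ?_⟩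
    change A⁻¹ * S.x' i * S.x i + -(A⁻¹ * w) * S.x j = 1
    have := S.x_mul_x' i
    rw [hE] at this
    rw [show A⁻¹ * S.x' i * S.x i + -(A⁻¹ * w) * S.x j =
      A⁻¹ * (S.x i * S.x' i) - A⁻¹ * w * S.x j by ring, this]
    field_simp
    ring
  obtain ⟨u, v, huv⟩ := hcop.pow (m := a) (n := b)
  have huv' : (u : F) * S.x i ^ a + (v : F) * S.x j ^ b = 1 := congrArg Subtype.val huv
  have : f = (u : F) * (S.x i ^ a * f) + (v : F) * (S.x j ^ b * f) := by
    linear_combination (-f) * huv'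
  rw [this]
  exact add_mem (mul_mem u.2 ha) (mul_mem v.2 hb)

end Seed

/-- The rank two exchange identity: `U * A ^ m + z ^ m` is divisible by `x` if `U * y ^ m + 1` is
and `y * z ≡ A` modulo `x`. -/
lemma exists_rank_two_exchange {E : Type*} [Field E] {W : Type*} [SetLike W E] [SubringClass W E]
    {M : W} {x y z A U w g : E} {m : ℕ} (hx : x ∈ M) (hy : y ∈ M) (hz : z ∈ M) (hU : U ∈ M)
    (hA : A ∈ M) (hw : w ∈ M) (hg : g ∈ M) (h1 : y * z = A + x * w) (h2 : x * g = U * y ^ m + 1) :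
    ∃ r ∈ M, U * A ^ m + z ^ m = x * r := by
  have hdvd : (⟨x, hx⟩ : M) ∣ (⟨A, hA⟩ : M) ^ m - (⟨y * z, mul_mem hy hz⟩ : M) ^ m := by
    refine Dvd.dvd.trans ⟨⟨-w, neg_mem hw⟩, Subtype.ext ?_⟩ (sub_dvd_pow_sub_pow _ _ m)
    change A - y * z = x * -w
    rw [h1]; ring
  obtain ⟨q, hq⟩ := hdvd
  have hq' : A ^ m - (y * z) ^ m = x * (q : E) := congrArg Subtype.val hq
  refine ⟨g * z ^ m + U * q, add_mem (mul_mem hg (pow_mem hz _)) (mul_mem hU q.2), ?_⟩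
  rw [mul_pow] at hq'
  linear_combination U * hq' - z ^ m * h2

namespace Seed

variable {P : Type u} [CommGroup P] [IsMulTorsionFree P]
  {F : Type v} [Field F] [Algebra (GroundField P) F] [Algebra (GroundRing P) F] {n : ℕ}
  [IsScalarTower (GroundRing P) (GroundField P) F]

lemma IsMutation.x'_mem_bound_of_nonneg {S S' : Seed P F n} {k j : Fin n} (h : IsMutation k S S')
    (hjk : j ≠ k) (hb : 0 ≤ S.B k j) : S'.x' j ∈ S.bound {k, j} := by
  obtain ⟨m, hm⟩ := Int.eq_ofNat_of_zero_le hb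
  have hd := S.isSignSkewSymmetric.diag
  set R := (Finset.univ : Finset (Fin n)).erase k with hR
  have hRk : ∀ l ∈ R, l ≠ k := fun l hl => Finset.ne_of_mem_erase hl
  have hB' : ∀ l ∈ R, S'.B l j = S.B l j + ((S.B l k).toNat : ℤ) * m := by
    intro l hl
    rw [h.matrix_eq, matrixMutation_of_ne _ _ (hRk l hl) hjk, hm, Int.toNat_eq_max]
    simp
  set U : F := coeffHom F (S.pPos j / S.pNeg j) * ∏ l ∈ R, S.x l ^ S.B l j with hU
  set A : F := coeffHom F (S.pPos k) * ∏ l ∈ R, S.x l ^ (S.B l k).toNat with hA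
  set V : F := coeffHom F (S.pNeg j) * ∏ l ∈ R, S.x l ^ (-S.B l j).toNat with hV
  set V' : F := coeffHom F (S'.pNeg j) * ∏ l ∈ R, S.x l ^ (-S'.B l j).toNat with hV'
  have hUmem : U ∈ S.bound {k, j} := by
    refine mul_mem (coeffHom_mem _ _) (prod_mem fun l hl => S.zpow_mem_bound ?_)
    rintro (rfl | rfl)
    · exact absurd rfl (hRk _ hl)
    · exact hd _
  have hVinv : V⁻¹ ∈ S.bound {k, j} := by
    rw [hV, mul_inv, ← Finset.prod_inv_distrib]
    refine mul_mem (coeffHom_inv_mem _ _) (prod_mem fun l hl => ?_)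
    rw [← zpow_natCast, ← zpow_neg]
    refine S.zpow_mem_bound ?_
    rintro (rfl | rfl)
    · exact absurd rfl (hRk _ hl)
    · simp [hd]
  have hV0 : V ≠ 0 := mul_ne_zero (coeffHom_ne_zero _)
    (Finset.prod_ne_zero_iff.2 fun l _ => pow_ne_zero _ (S.x_ne_zero l))
  have hzpow : ∀ b : Fin n → ℤ, ∏ l ∈ R, S.x l ^ (b l).toNat =
      (∏ l ∈ R, S.x l ^ (-b l).toNat) * ∏ l ∈ R, S.x l ^ b l := by
    intro b
    rw [← Finset.prod_mul_distrib]
    refine Finset.prod_congr rfl fun l _ => ?_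
    rw [← zpow_natCast, ← zpow_natCast, ← zpow_add₀ (S.x_ne_zero l)]
    congr 1
    omega
  have hE : S.exchangeElement j = V * (U * S.x k ^ m + 1) := by
    have hc : coeffHom F (S.pPos j) = coeffHom F (S.pNeg j) * coeffHom F (S.pPos j / S.pNeg j) := by
      rw [← map_mul, mul_div_cancel]
    rw [exchangeElement_eq, binomial, ← Finset.mul_prod_erase _ _ (Finset.mem_univ k),
      ← Finset.mul_prod_erase _ _ (Finset.mem_univ k), hm, Int.toNat_natCast,
      Int.toNat_neg_natCast, pow_zero, ← hR, hzpow fun l => S.B l j, hc, hU, hV]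
    ring
  have hE' : S'.exchangeElement j = V' * (U * A ^ m + S.x' k ^ m) := by
    have hc : coeffHom F (S'.pPos j) = coeffHom F (S'.pNeg j) *
        (coeffHom F (S.pPos k) ^ m * coeffHom F (S.pPos j / S.pNeg j)) := by
      have := h.ratio_of_nonneg j hjk hb
      rw [hm, zpow_natCast, div_eq_iff_eq_mul] at this
      rw [this, map_mul, map_mul, map_pow]; ring
    have hprod : ∀ e : Fin n → ℕ, ∏ l ∈ R, S'.x l ^ e l = ∏ l ∈ R, S.x l ^ e l := fun e =>
      Finset.prod_congr rfl fun l hl => by rw [h.x_of_ne l (hRk l hl)]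
    have hsplit : ∏ l ∈ R, S.x l ^ S'.B l j =
        (∏ l ∈ R, S.x l ^ S.B l j) * (∏ l ∈ R, S.x l ^ (S.B l k).toNat) ^ m := by
      rw [← Finset.prod_pow, ← Finset.prod_mul_distrib]
      refine Finset.prod_congr rfl fun l hl => ?_
      rw [hB' l hl, zpow_add₀ (S.x_ne_zero l), zpow_mul, zpow_natCast, zpow_natCast]
    have hBk : S'.B k j = -(m : ℤ) := by rw [h.matrix_eq, matrixMutation_left, hm]
    rw [exchangeElement_eq, binomial, ← Finset.mul_prod_erase _ _ (Finset.mem_univ k),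
      ← Finset.mul_prod_erase _ _ (Finset.mem_univ k), hBk, neg_neg, Int.toNat_natCast,
      Int.toNat_neg_natCast, pow_zero, ← hR, hprod fun l => (S'.B l j).toNat,
      hprod fun l => (-S'.B l j).toNat, hzpow fun l => S'.B l j, hsplit, hc, hU, hV', hA, h.x_self]
    ring
  have hV'mem : V' ∈ S.bound {k, j} := mul_mem (coeffHom_mem _ _) (S.prod_mem_bound _ _)
  have hAmem : A ∈ S.bound {k, j} := mul_mem (coeffHom_mem _ _) (S.prod_mem_bound _ _)
  have key : ∃ r ∈ S.bound {k, j}, U * A ^ m + S.x' k ^ m = S.x j * r := by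
    have h2 : S.x j * (V⁻¹ * S.x' j) = U * S.x k ^ m + 1 := by
      rw [mul_left_comm, S.x_mul_x', hE, inv_mul_cancel_left₀ hV0]
    have hg : V⁻¹ * S.x' j ∈ S.bound {k, j} := mul_mem hVinv (S.x'_mem_bound j)
    rcases Nat.eq_zero_or_pos m with hm0 | hm0
    · exact ⟨_, hg, by rw [h2, hm0]; simp⟩
    have hneg : S.B j k < 0 :=
      (S.isSignSkewSymmetric.neg_iff k j).1 (by rw [hm]; exact_mod_cast hm0)
    refine exists_rank_two_exchange (S.x_mem_bound j) (S.x_mem_bound k) (S.x'_mem_bound k) hUmem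
      hAmem (w := coeffHom F (S.pNeg k) * (S.x j ^ ((-S.B j k).toNat - 1) *
        ∏ l ∈ Finset.univ.erase j, S.x l ^ (-S.B l k).toNat))
      (mul_mem (coeffHom_mem _ _) (mul_mem (pow_mem (S.x_mem_bound j) _) (S.prod_mem_bound _ _)))
      hg ?_ h2
    have hpow : S.x j ^ (-S.B j k).toNat = S.x j ^ ((-S.B j k).toNat - 1) * S.x j := by
      rw [← pow_succ]; congr 1; omega
    rw [S.x_mul_x', exchangeElement_eq, binomial, ← Finset.mul_prod_erase _ _ (Finset.mem_univ k),
      ← Finset.mul_prod_erase _ (fun l => S.x l ^ (-S.B l k).toNat) (Finset.mem_univ j), hpow,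
      hd, Int.toNat_zero, pow_zero, one_mul, hA]
    ring
  obtain ⟨r, hr, hrx⟩ := key
  have : S'.x' j = V' * r := by
    rw [x', hE', hrx, h.x_of_ne j hjk, mul_left_comm, mul_div_cancel_left₀ _ (S.x_ne_zero j)]
  rw [this]
  exact mul_mem hV'mem hr

lemma IsMutation.x'_mem_bound {S S' : Seed P F n} {k j : Fin n} (h : IsMutation k S S')
    (hjk : j ≠ k) : S'.x' j ∈ S.bound {k, j} := by
  rcases le_total 0 (S.B k j) with hb | hb
  · exact h.x'_mem_bound_of_nonneg hjk hb
  · rw [← opp_x', ← S.opp_bound]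
    exact h.opp.x'_mem_bound_of_nonneg hjk (by simpa [Seed.opp] using hb)

lemma IsMutation.x'_self {S S' : Seed P F n} {k : Fin n} (h : IsMutation k S S') :
    S'.x' k = S.x k := by
  rw [x', h.exchangeElement_self, ← h.exchange, mul_div_cancel_right₀]
  rw [h.x_self]; exact S.x'_ne_zero k

lemma IsMutation.bound_le_bound {S S' : Seed P F n} {k j : Fin n} (h : IsMutation k S S') :
    S'.bound {k, j} ≤ S.bound {k, j} := by
  refine S'.bound_le (fun i => ?_) ?_ fun i hi => ?_
  · by_cases hi : i = k
    · subst hi; rw [h.x_self]; exact S.x'_mem_bound i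
    · rw [h.x_of_ne i hi]; exact S.x_mem_bound i
  · have hk : S'.x' k ∈ S.bound {k, j} := by rw [h.x'_self]; exact S.x_mem_bound k
    rintro i (rfl | rfl)
    · exact hk
    · by_cases hik : i = k
      · rw [hik] at hk ⊢; exact hk
      · exact h.x'_mem_bound hik
  · rw [h.x_of_ne i fun hik => hi (Or.inl hik)]
    exact S.inv_mem_bound hi

lemma IsMutation.bound_eq {S S' : Seed P F n} {k j : Fin n} (h : IsMutation k S S') :
    S'.bound {k, j} = S.bound {k, j} :=
  le_antisymm h.bound_le_bound h.symm.bound_le_bound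

end Seed

section LaurentExpansion

open Polynomial

variable {E : Type*} [Field E]

/-- `f` has a finite Laurent expansion in `x` whose coefficient of `x ^ n` lies in `I n`. -/
def HasExpansion (I : ℤ → Set E) (x f : E) : Prop :=
  ∃ (N : ℕ) (p : E[X]), x ^ N * f = p.eval x ∧ ∀ j : ℕ, p.coeff j ∈ I (j - N)

lemma HasExpansion.inter {I I' : ℤ → Set E} {x f : E} {K : Type*} [Field K] [Algebra K E]
    {C : IntermediateField K E} (hx : Transcendental C x) (h : HasExpansion I x f)
    (h' : HasExpansion I' x f) (h0 : ∀ n, (0 : E) ∈ I n) (h0' : ∀ n, (0 : E) ∈ I' n)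
    (hC : ∀ n, I n ⊆ C) (hC' : ∀ n, I' n ⊆ C) : HasExpansion (fun n => I n ∩ I' n) x f := by
  obtain ⟨N, p, hp, hpI⟩ := h
  obtain ⟨N', p', hp', hpI'⟩ := h'
  have hshift : ∀ (J : ℤ → Set E) (_ : ∀ n, (0 : E) ∈ J n) (q : E[X]) (M M' : ℕ)
      (_ : ∀ j : ℕ, q.coeff j ∈ J (j - M)) (j : ℕ),
      (X ^ M' * q).coeff j ∈ J (j - (M + M' : ℕ)) := by
    intro J hJ q M M' hq j
    rw [coeff_X_pow_mul']
    split_ifs with hj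
    · have := hq (j - M')
      rwa [show (((j - M' : ℕ) : ℤ) - M) = j - (M + M' : ℕ) by omega] at this
    · exact hJ _
  have heq : X ^ N' * p = X ^ N * p' := by
    have hmem : ∀ j, (X ^ N' * p - X ^ N * p').coeff j ∈ C := by
      intro j
      rw [coeff_sub]
      exact sub_mem (hC _ (hshift I h0 p N N' hpI j)) (hC' _ (hshift I' h0' p' N' N hpI' j))
    obtain ⟨r, hr⟩ : ∃ r : C[X], r.map (algebraMap C E) = X ^ N' * p - X ^ N * p' := by
      have : X ^ N' * p - X ^ N * p' ∈ lifts (algebraMap C E) := by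
        rw [lifts_iff_coeff_lifts]
        exact fun j => ⟨⟨_, hmem j⟩, rfl⟩
      exact (mem_lifts _).1 this
    have hr0 : aeval x r = 0 := by
      rw [aeval_def, ← eval_map, hr]
      simp only [eval_sub, eval_mul, eval_pow, eval_X]
      rw [← hp, ← hp']; ring
    have : r = 0 := by
      by_contra hne
      exact hx ⟨r, hne, hr0⟩
    rw [this, Polynomial.map_zero] at hr
    exact (sub_eq_zero.1 hr.symm)
  refine ⟨N + N', X ^ N' * p, ?_, fun j => ⟨hshift I h0 p N N' hpI j, ?_⟩⟩
  · simp only [eval_mul, eval_pow, eval_X]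
    rw [← hp]; ring
  · rw [heq, add_comm]
    exact hshift I' h0' p' N' N hpI' j

/-- The powers `A P ^ (-n)` for `n < 0`, and `A` for `n ≥ 0`. -/
def powerFiltration {R : Type*} [CommRing R] [Algebra R E] (A : Subalgebra R E) (P : E) (n : ℤ) :
    Set E := {z | ∃ c ∈ A, z = c * P ^ (-n).toNat}

section

variable {R : Type*} [CommRing R] [Algebra R E] {A : Subalgebra R E} {P x f g : E}

lemma zero_mem_powerFiltration (n : ℤ) : (0 : E) ∈ powerFiltration A P n :=
  ⟨0, zero_mem _, by simp⟩

lemma add_mem_powerFiltration {n : ℤ} {y z : E} (hy : y ∈ powerFiltration A P n)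
    (hz : z ∈ powerFiltration A P n) : y + z ∈ powerFiltration A P n := by
  obtain ⟨c, hc, rfl⟩ := hy
  obtain ⟨d, hd, rfl⟩ := hz
  exact ⟨c + d, add_mem hc hd, by ring⟩

lemma sum_mem_powerFiltration {ι : Type*} {n : ℤ} (s : Finset ι) {z : ι → E}
    (hz : ∀ i ∈ s, z i ∈ powerFiltration A P n) : ∑ i ∈ s, z i ∈ powerFiltration A P n := by
  classical
  induction s using Finset.induction_on with
  | empty => simpa using zero_mem_powerFiltration n
  | insert i s hi ih =>
    rw [Finset.sum_insert hi]
    exact add_mem_powerFiltration (hz i (Finset.mem_insert_self _ _))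
      (ih fun j hj => hz j (Finset.mem_insert_of_mem hj))

lemma mul_mem_powerFiltration (hP : P ∈ A) {m n : ℤ} {y z : E} (hy : y ∈ powerFiltration A P m)
    (hz : z ∈ powerFiltration A P n) : y * z ∈ powerFiltration A P (m + n) := by
  obtain ⟨c, hc, rfl⟩ := hy
  obtain ⟨d, hd, rfl⟩ := hz
  refine ⟨c * d * P ^ ((-m).toNat + (-n).toNat - (-(m + n)).toNat),
    mul_mem (mul_mem hc hd) (pow_mem hP _), ?_⟩
  have : P ^ (-m).toNat * P ^ (-n).toNat =
      P ^ ((-m).toNat + (-n).toNat - (-(m + n)).toNat) * P ^ (-(m + n)).toNat := by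
    rw [← pow_add, ← pow_add]; congr 1; omega
  linear_combination c * d * this

lemma hasExpansion_of_mem {c : E} (hc : c ∈ A) : HasExpansion (powerFiltration A P) x c := by
  refine ⟨0, Polynomial.C c, by simp, fun j => ?_⟩
  rw [coeff_C]
  split_ifs with hj
  · subst hj; exact ⟨c, hc, by simp⟩
  · exact zero_mem_powerFiltration _

lemma hasExpansion_self : HasExpansion (powerFiltration A P) x x := by
  refine ⟨0, X, by simp, fun j => ?_⟩
  rw [coeff_X]
  split_ifs with hj
  · subst hj; exact ⟨1, one_mem _, by simp⟩
  · exact zero_mem_powerFiltration _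

lemma hasExpansion_div (hx : x ≠ 0) : HasExpansion (powerFiltration A P) x (P / x) := by
  refine ⟨1, Polynomial.C P, by simp [mul_div_cancel₀ _ hx], fun j => ?_⟩
  rw [coeff_C]
  split_ifs with hj
  · subst hj; exact ⟨1, one_mem _, by simp⟩
  · exact zero_mem_powerFiltration _

lemma HasExpansion.add (hf : HasExpansion (powerFiltration A P) x f)
    (hg : HasExpansion (powerFiltration A P) x g) :
    HasExpansion (powerFiltration A P) x (f + g) := by
  obtain ⟨N, p, hp, hpI⟩ := hf
  obtain ⟨N', p', hp', hpI'⟩ := hg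
  refine ⟨N + N', X ^ N' * p + X ^ N * p', ?_, fun j => ?_⟩
  · simp only [eval_add, eval_mul, eval_pow, eval_X]
    rw [← hp, ← hp']; ring
  · rw [coeff_add, coeff_X_pow_mul', coeff_X_pow_mul']
    refine add_mem_powerFiltration ?_ ?_
    · split_ifs with hj
      · have := hpI (j - N')
        rwa [show (((j - N' : ℕ) : ℤ) - N) = j - (N + N' : ℕ) by omega] at this
      · exact zero_mem_powerFiltration _
    · split_ifs with hj
      · have := hpI' (j - N)
        rwa [show (((j - N : ℕ) : ℤ) - N') = j - (N + N' : ℕ) by omega] at this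
      · exact zero_mem_powerFiltration _

lemma HasExpansion.mul (hP : P ∈ A) (hf : HasExpansion (powerFiltration A P) x f)
    (hg : HasExpansion (powerFiltration A P) x g) :
    HasExpansion (powerFiltration A P) x (f * g) := by
  obtain ⟨N, p, hp, hpI⟩ := hf
  obtain ⟨N', p', hp', hpI'⟩ := hg
  refine ⟨N + N', p * p', ?_, fun j => ?_⟩
  · rw [eval_mul, ← hp, ← hp']; ring
  · rw [coeff_mul]
    refine sum_mem_powerFiltration _ fun ab hab => ?_
    have hab : ab.1 + ab.2 = j := by simpa using hab
    have := mul_mem_powerFiltration hP (hpI ab.1) (hpI' ab.2)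
    rwa [show ((ab.1 : ℤ) - N) + (ab.2 - N') = j - (N + N' : ℕ) by push_cast [← hab]; ring] at this

/-- Elements of an algebra generated over `A` by `x` and `P / x` have expansions. -/
lemma hasExpansion_of_mem_adjoin (hP : P ∈ A) {s : Set E}
    (hs : ∀ z ∈ s, HasExpansion (powerFiltration A P) x z) {f : E} (hf : f ∈ Algebra.adjoin R s) :
    HasExpansion (powerFiltration A P) x f := by
  induction hf using Algebra.adjoin_induction with
  | mem z hz => exact hs z hz
  | algebraMap r => exact hasExpansion_of_mem (A.algebraMap_mem r)
  | add f g _ _ hf hg => exact hf.add hg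
  | mul f g _ _ hf hg => exact hf.mul hP hg

lemma HasExpansion.mem {W : Subalgebra R E} (hx0 : x ≠ 0) (hA : A ≤ W) (hx : x ∈ W)
    (hPx : P / x ∈ W) (hf : HasExpansion (powerFiltration A P) x f) : f ∈ W := by
  obtain ⟨N, p, hp, hpI⟩ := hf
  have : f = ∑ j ∈ Finset.range (p.natDegree + 1), p.coeff j * x ^ j * (x ^ N)⁻¹ := by
    rw [← Finset.sum_mul, ← eval_eq_sum_range, ← hp]
    field_simp
  rw [this]
  refine sum_mem fun j _ => ?_
  obtain ⟨c, hc, hcj⟩ := hpI j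
  rw [hcj]
  rcases le_total N j with h | h
  · rw [Int.toNat_of_nonpos (by omega), pow_zero, mul_one, mul_assoc,
      show x ^ j * (x ^ N)⁻¹ = x ^ (j - N) by rw [pow_sub₀ _ hx0 h]]
    exact mul_mem (hA hc) (pow_mem hx _)
  · rw [show (-((j : ℤ) - N)).toNat = N - j by omega]
    have : c * P ^ (N - j) * x ^ j * (x ^ N)⁻¹ = c * (P / x) ^ (N - j) := by
      rw [div_pow, pow_sub₀ x hx0 h]
      field_simp
    rw [this]
    exact mul_mem (hA hc) (pow_mem hPx _)

end

end LaurentExpansion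

section Coprime

variable {E : Type*} [Field E] {R : Type*} [CommRing R] [Algebra R E]

lemma dvd_of_pow_mul_eq {Q : Subalgebra R E} {p q : E} (hp : p ∈ Q) (hp0 : p ≠ 0) (hq : q ∈ Q)
    (h : ∀ a ∈ Q, ∀ b ∈ Q, p * a = q * b → ∃ c ∈ Q, b = p * c) (k m : ℕ) :
    ∀ a ∈ Q, ∀ b ∈ Q, p ^ k * a = q ^ m * b → ∃ c ∈ Q, b = p ^ k * c := by
  have h1 : ∀ m : ℕ, ∀ a ∈ Q, ∀ b ∈ Q, p * a = q ^ m * b → ∃ c ∈ Q, b = p * c := by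
    intro m
    induction m with
    | zero => intro a ha b _ hab; exact ⟨a, ha, by rw [hab]; simp⟩
    | succ m ih =>
      intro a ha b hb hab
      obtain ⟨c, hc, hbc⟩ := h a ha (q ^ m * b) (mul_mem (pow_mem hq _) hb) (by rw [hab]; ring)
      exact ih c hc b hb hbc.symm
  induction k with
  | zero => intro a _ b hb _; exact ⟨b, hb, by simp⟩
  | succ k ih =>
    intro a ha b hb hab
    obtain ⟨c, hc, rfl⟩ := h1 m (p ^ k * a) (mul_mem (pow_mem hp _) ha) b hb
      (by rw [← hab]; ring)
    obtain ⟨d, hd, rfl⟩ := ih a ha c hc (mul_left_cancel₀ hp0 (by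
      rw [show p * (p ^ k * a) = p ^ (k + 1) * a by ring, hab]; ring))
    exact ⟨d, hd, by ring⟩

end Coprime

namespace Seed

variable {P : Type u} [CommGroup P] [IsMulTorsionFree P]
  {F : Type v} [Field F] [Algebra (GroundField P) F] [Algebra (GroundRing P) F] {n : ℕ}
  [IsScalarTower (GroundRing P) (GroundField P) F]

/-- Laurent polynomials in the cluster variables with index in `s`. -/
noncomputable def laurent (S : Seed P F n) (s : Set (Fin n)) : Subalgebra (GroundRing P) F :=
  Algebra.adjoin (GroundRing P) (S.x '' s ∪ (fun i => (S.x i)⁻¹) '' s)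

variable (S : Seed P F n)

lemma x_mem_laurent {s : Set (Fin n)} {i : Fin n} (hi : i ∈ s) : S.x i ∈ S.laurent s :=
  Algebra.subset_adjoin (Or.inl ⟨i, hi, rfl⟩)

lemma inv_mem_laurent {s : Set (Fin n)} {i : Fin n} (hi : i ∈ s) : (S.x i)⁻¹ ∈ S.laurent s :=
  Algebra.subset_adjoin (Or.inr ⟨i, hi, rfl⟩)

lemma laurent_mono {s t : Set (Fin n)} (h : s ⊆ t) : S.laurent s ≤ S.laurent t :=
  Algebra.adjoin_mono (Set.union_subset_union (Set.image_mono h) (Set.image_mono h))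

lemma laurent_subset_intermediateField {s : Set (Fin n)} :
    (S.laurent s : Set F) ⊆ IntermediateField.adjoin (GroundField P) (S.x '' s) := by
  intro z hz
  induction hz using Algebra.adjoin_induction with
  | mem z hz =>
    rcases hz with ⟨i, hi, rfl⟩ | ⟨i, hi, rfl⟩
    · exact IntermediateField.subset_adjoin _ _ ⟨i, hi, rfl⟩
    · exact inv_mem (IntermediateField.subset_adjoin _ _ ⟨i, hi, rfl⟩)
  | algebraMap r =>
    rw [IsScalarTower.algebraMap_apply (GroundRing P) (GroundField P) F]
    exact IntermediateField.algebraMap_mem _ _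
  | add x y _ _ hx hy => exact add_mem hx hy
  | mul x y _ _ hx hy => exact mul_mem hx hy

lemma exchangeElement_mem_laurent {s : Set (Fin n)} {i : Fin n}
    (hs : ∀ l, l ∉ s → S.B l i = 0) : S.exchangeElement i ∈ S.laurent s := by
  rw [exchangeElement_eq, binomial]
  refine add_mem (mul_mem (coeffHom_mem _ _) (prod_mem fun l _ => ?_))
    (mul_mem (coeffHom_mem _ _) (prod_mem fun l _ => ?_)) <;>
  · by_cases hl : l ∈ s
    · exact pow_mem (S.x_mem_laurent hl) _
    · simp [hs l hl]

lemma laurent_le_bound {s t : Set (Fin n)} (h : ∀ i ∈ t, i ∉ s) : S.laurent t ≤ S.bound s := by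
  refine Algebra.adjoin_le ?_
  rintro _ (⟨i, _, rfl⟩ | ⟨i, hi, rfl⟩)
  · exact S.x_mem_bound i
  · exact S.inv_mem_bound (h i hi)

/-- The gluing principle for directions with `b i j = 0`, under a coprimality assumption on the
exchange elements. -/
lemma mem_bound_pair_of_coprime {i j : Fin n} (hij : i ≠ j) (hB : S.B i j = 0) (hB' : S.B j i = 0)
    (hcop : ∀ a ∈ S.laurent {i, j}ᶜ, ∀ b ∈ S.laurent {i, j}ᶜ,
      S.exchangeElement i * a = S.exchangeElement j * b →
        ∃ c ∈ S.laurent {i, j}ᶜ, b = S.exchangeElement i * c)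
    {f : F} (hfi : f ∈ S.bound {i}) (hfj : f ∈ S.bound {j}) : f ∈ S.bound {i, j} := by
  have hd := S.isSignSkewSymmetric.diag
  set Q := S.laurent {i, j}ᶜ with hQ
  set V := S.laurent {j}ᶜ with hV
  set W : Subalgebra (GroundRing P) F := Q ⊔ Algebra.adjoin (GroundRing P) {S.x i, S.x' i} with hW
  have hQV : Q ≤ V := S.laurent_mono (by simp)
  have hPi : S.exchangeElement i ∈ Q := S.exchangeElement_mem_laurent fun l hl => by
    rcases not_not.1 hl with rfl | rfl
    exacts [hd _, hB']
  have hPj : S.exchangeElement j ∈ Q := S.exchangeElement_mem_laurent fun l hl => by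
    rcases not_not.1 hl with rfl | rfl
    exacts [hB, hd _]
  have hQW : Q ≤ W := le_sup_left
  have hxW : S.x i ∈ W := le_sup_right (a := Q) (Algebra.subset_adjoin (by simp))
  have hx'W : S.x' i ∈ W := le_sup_right (a := Q) (Algebra.subset_adjoin (by simp))
  have hx'V : S.x' i ∈ V := by
    rw [x', div_eq_mul_inv]
    exact mul_mem (hQV hPi) (S.inv_mem_laurent (by simpa using hij))
  have hWV : W ≤ V := by
    refine sup_le hQV (Algebra.adjoin_le ?_)
    rintro _ (rfl | rfl)
    · exact S.x_mem_laurent (by simpa using hij)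
    · exact hx'V
  have hWadj : W = Algebra.adjoin (GroundRing P) ((S.x '' {i, j}ᶜ ∪
      (fun l => (S.x l)⁻¹) '' {i, j}ᶜ) ∪ {S.x i, S.x' i}) := by
    rw [Algebra.adjoin_union]; rfl
  have hWi : W ≤ S.bound {i, j} := by
    refine sup_le (S.laurent_le_bound fun l hl => hl) (Algebra.adjoin_le ?_)
    rintro _ (rfl | rfl)
    · exact S.x_mem_bound i
    · exact S.x'_mem_bound i
  have hxi0 := S.x_ne_zero i
  have hxj0 := S.x_ne_zero j
  have hEi0 := S.exchangeElement_ne_zero i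
  have hEj0 := S.exchangeElement_ne_zero j
  have hQC : (Q : Set F) ⊆ IntermediateField.adjoin (GroundField P) (S.x '' {i}ᶜ) :=
    fun z hz => S.laurent_subset_intermediateField (S.laurent_mono (by simp) hz)
  have hVC : (V : Set F) ⊆ IntermediateField.adjoin (GroundField P) (S.x '' {j}ᶜ) :=
    S.laurent_subset_intermediateField
  have hfilt : ∀ {A : Subalgebra (GroundRing P) F} {p : F}, p ∈ A → ∀ m,
      powerFiltration A p m ⊆ A := by
    rintro A p hp m _ ⟨c, hc, rfl⟩
    exact mul_mem hc (pow_mem hp _)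
  have hdiv : ∀ t ∈ V, ∀ m : ℕ, t * S.exchangeElement j ^ m ∈ W → t ∈ W := by
    intro t ht m hu
    have e1 : HasExpansion (powerFiltration Q (S.exchangeElement i)) (S.x i)
        (t * S.exchangeElement j ^ m) := by
      rw [hWadj] at hu
      refine hasExpansion_of_mem_adjoin hPi ?_ hu
      rintro z (hz | rfl | rfl)
      · exact hasExpansion_of_mem (Algebra.subset_adjoin hz)
      · exact hasExpansion_self
      · exact hasExpansion_div hxi0
    have e2 : HasExpansion (powerFiltration Q 1) (S.x i) t := by
      refine hasExpansion_of_mem_adjoin (one_mem _) ?_ ht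
      rintro _ (⟨l, hl, rfl⟩ | ⟨l, hl, rfl⟩)
      · by_cases hli : l = i
        · subst hli; exact hasExpansion_self
        · exact hasExpansion_of_mem (S.x_mem_laurent (by simp_all))
      · by_cases hli : l = i
        · subst hli
          simpa using hasExpansion_div (P := 1) (A := Q) hxi0
        · exact hasExpansion_of_mem (S.inv_mem_laurent (by simp_all))
    have e3 : HasExpansion (fun _ => {z | ∃ c ∈ Q, z = c * S.exchangeElement j ^ m}) (S.x i)
        (t * S.exchangeElement j ^ m) := by
      obtain ⟨N, p, hp, hpI⟩ := e2
      refine ⟨N, p * Polynomial.C (S.exchangeElement j ^ m), ?_, fun l => ?_⟩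
      · rw [Polynomial.eval_mul, Polynomial.eval_C, ← hp, mul_assoc]
      · rw [Polynomial.coeff_mul_C]
        exact ⟨_, hfilt (one_mem Q) _ (hpI l), rfl⟩
    obtain ⟨N, p, hp, hpI⟩ := e1.inter (transcendental_adjoin_compl S.isTranscendenceBasis.1 i) e3
      zero_mem_powerFiltration (fun _ => ⟨0, zero_mem _, by simp⟩)
      (fun m => (hfilt hPi m).trans hQC)
      (by rintro _ _ ⟨c, hc, rfl⟩; exact hQC (mul_mem hc (pow_mem hPj _)))
    have hEm : S.exchangeElement j ^ m ≠ 0 := pow_ne_zero _ hEj0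
    refine HasExpansion.mem (A := Q) (P := S.exchangeElement i) hxi0 hQW hxW hx'W
      ⟨N, p * Polynomial.C (S.exchangeElement j ^ m)⁻¹, ?_, fun l => ?_⟩
    · rw [Polynomial.eval_mul, Polynomial.eval_C, ← hp]
      field_simp
    · rw [Polynomial.coeff_mul_C]
      obtain ⟨⟨a, ha, hpa⟩, b, hb, hpb⟩ := hpI l
      obtain ⟨c, hc, hbc⟩ := dvd_of_pow_mul_eq hPi hEi0 hPj hcop (-((l : ℤ) - N)).toNat m a ha b hb
        (by rw [mul_comm, ← hpa, hpb, mul_comm])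
      refine ⟨c, hc, ?_⟩
      rw [hpb, hbc, mul_inv_cancel_right₀ hEm, mul_comm]
  have f1 : HasExpansion (powerFiltration W 1) (S.x j) f := by
    refine hasExpansion_of_mem_adjoin (one_mem _) ?_ hfi
    rintro _ ((⟨l, rfl⟩ | ⟨l, rfl, rfl⟩) | ⟨l, hl, rfl⟩)
    · by_cases hlj : l = j
      · subst hlj; exact hasExpansion_self
      · by_cases hli : l = i
        · subst hli; exact hasExpansion_of_mem hxW
        · exact hasExpansion_of_mem (hQW (S.x_mem_laurent (by simp_all)))
    · exact hasExpansion_of_mem hx'W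
    · by_cases hlj : l = j
      · subst hlj
        simpa using hasExpansion_div (P := 1) (A := W) hxj0
      · exact hasExpansion_of_mem (hQW (S.inv_mem_laurent (by simp_all)))
  have f2 : HasExpansion (powerFiltration V (S.exchangeElement j)) (S.x j) f := by
    refine hasExpansion_of_mem_adjoin (hQV hPj) ?_ hfj
    rintro _ ((⟨l, rfl⟩ | ⟨l, rfl, rfl⟩) | ⟨l, hl, rfl⟩)
    · by_cases hlj : l = j
      · subst hlj; exact hasExpansion_self
      · exact hasExpansion_of_mem (S.x_mem_laurent hlj)
    · exact hasExpansion_div hxj0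
    · exact hasExpansion_of_mem (S.inv_mem_laurent hl)
  obtain ⟨N, p, hp, hpI⟩ := f1.inter (transcendental_adjoin_compl S.isTranscendenceBasis.1 j) f2
    zero_mem_powerFiltration zero_mem_powerFiltration
    (fun m z hz => hVC (hWV (hfilt (one_mem W) m hz))) (fun m => (hfilt (hQV hPj) m).trans hVC)
  refine HasExpansion.mem (A := W) (P := S.exchangeElement j) hxj0 hWi (S.x_mem_bound j)
    (S.x'_mem_bound j) ⟨N, p, hp, fun l => ?_⟩
  obtain ⟨h1, t, ht, hpt⟩ := hpI l
  refine ⟨t, hdiv t ht (-((l : ℤ) - N)).toNat ?_, hpt⟩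
  rw [← hpt]
  exact hfilt (one_mem W) _ h1

end Seed

section Retraction

variable {Q : Type*} [CommRing Q]

lemma dvd_zpow_sub_one {p : Q} {w : Qˣ} (h : p ∣ (w : Q) - 1) (k : ℤ) :
    p ∣ ((w ^ k : Qˣ) : Q) - 1 := by
  rw [← Ideal.mem_span_singleton, ← Ideal.Quotient.eq, map_one] at h ⊢
  have h1 : Units.map (Ideal.Quotient.mk (Ideal.span {p})).toMonoidHom w = 1 := Units.ext h
  have h2 := map_zpow (Units.map (Ideal.Quotient.mk (Ideal.span {p})).toMonoidHom) w k
  rw [h1, one_zpow] at h2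
  exact congrArg Units.val h2

lemma exists_unit_of_mul_eq_one {g g' : Q} (h : g' * g = 1) :
    ∃ w : Qˣ, 1 + (w : Q) * g = 0 ∧ 1 + g ∣ (w : Q) - 1 := by
  refine ⟨⟨-g', -g, by rw [neg_mul_neg, h], by rw [neg_mul_neg, mul_comm, h]⟩, ?_, -g', ?_⟩
  · change 1 + -g' * g = 0
    linear_combination -h
  · change -g' - 1 = (1 + g) * -g'
    linear_combination h

lemma dvd_of_retraction [IsDomain Q] {p q a b : Q} (ψ : Q →+* Q) (hp : ψ p = 0) (hq : ψ q = q)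
    (hq0 : q ≠ 0) (hψ : ∀ c, p ∣ c - ψ c) (h : p * a = q * b) : p ∣ b := by
  have h1 := congrArg ψ h
  rw [map_mul, map_mul, hp, hq, zero_mul, zero_eq_mul] at h1
  simpa [h1.resolve_left hq0] using hψ b

lemma dvd_sub_add {p a b a' b' : Q} (h : p ∣ a - a') (h' : p ∣ b - b') :
    p ∣ a + b - (a' + b') := by
  have := dvd_add h h'
  rwa [show a + b - (a' + b') = a - a' + (b - b') by ring]

lemma dvd_sub_mul {p a b a' b' : Q} (h : p ∣ a - a') (h' : p ∣ b - b') :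
    p ∣ a * b - a' * b' := by
  have := dvd_add (h.mul_right b) (h'.mul_left a')
  rwa [show a * b - a' * b' = (a - a') * b + a' * (b - b') by ring]

end Retraction

open LaurentPolynomial in
/-- The Laurent monomial `p * T ^ n`. -/
noncomputable def laurentMonomial {P : Type*} [CommGroup P] (p : P) (n : ℤ) :
    LaurentPolynomial (GroundRing P) := C (MonoidAlgebra.of ℤ P p) * T n

section LaurentMonomial

open LaurentPolynomial

variable {P : Type*} [CommGroup P]

lemma laurentMonomial_mul (p q : P) (m n : ℤ) :
    laurentMonomial p m * laurentMonomial q n = laurentMonomial (p * q) (m + n) := by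
  simp only [laurentMonomial, map_mul, T_add]
  ring

lemma laurentMonomial_one : laurentMonomial (1 : P) 0 = 1 := by
  rw [laurentMonomial, map_one, map_one, T_zero, one_mul]

lemma one_add_laurentMonomial_ne_zero (p : P) (n : ℤ) : 1 + laurentMonomial p n ≠ 0 := by
  intro h
  have := congrArg (eval₂ (MonoidAlgebra.lift ℤ ℤ P (1 : P →* ℤ)).toRingHom (1 : ℤˣ)) h
  simp [laurentMonomial, eval₂_C_mul_T] at this

/-- If a character of `P` separates `r` from `s`, then `1 + r * T ^ m` is coprime to
`1 + s * T ^ n`. -/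
lemma dvd_of_one_add_laurentMonomial_mul [IsMulTorsionFree P] {χ : P →* Multiplicative ℤ} {r s : P}
    (hr : χ r = Multiplicative.ofAdd 1) (hs : χ s = 1) (m n : ℤ)
    {a b : LaurentPolynomial (GroundRing P)}
    (h : (1 + laurentMonomial r m) * a = (1 + laurentMonomial s n) * b) :
    1 + laurentMonomial r m ∣ b := by
  obtain ⟨w, hw, hw'⟩ := exists_unit_of_mul_eq_one
    (show laurentMonomial r⁻¹ (-m) * laurentMonomial r m = 1 by
      rw [laurentMonomial_mul, inv_mul_cancel, neg_add_cancel, laurentMonomial_one])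
  let φ : P →* LaurentPolynomial (GroundRing P) :=
    (C.toMonoidHom.comp (MonoidAlgebra.of ℤ P)) *
      ((Units.coeHom _).comp ((zpowersHom _ w).comp χ))
  have hT1 : (T 1 : LaurentPolynomial (GroundRing P)) * T (-1) = 1 := by rw [← T_add]; simp
  let τ : (LaurentPolynomial (GroundRing P))ˣ := ⟨T 1, T (-1), hT1, by rw [mul_comm, hT1]⟩
  let ψ : LaurentPolynomial (GroundRing P) →+* LaurentPolynomial (GroundRing P) :=
    eval₂ (MonoidAlgebra.lift ℤ (LaurentPolynomial (GroundRing P)) P φ).toRingHom τ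
  have hT : ∀ k : ℤ, (τ ^ k).val = T k := by
    intro k
    obtain ⟨l, rfl | rfl⟩ := k.eq_nat_or_neg
    · simp [τ, T_pow]
    · rw [zpow_neg, zpow_natCast, ← inv_pow, Units.val_pow_eq_pow_val]
      simp [τ, T_pow]
  have hψC : ∀ p, ψ (C (MonoidAlgebra.of ℤ P p)) =
      C (MonoidAlgebra.of ℤ P p) * ((w ^ (χ p).toAdd : (LaurentPolynomial (GroundRing P))ˣ) :
        LaurentPolynomial (GroundRing P)) := by
    intro p
    simp only [ψ]
    rw [eval₂_C]
    simp [φ]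
  have hψT : ∀ k : ℤ, ψ (T k) = T k := by
    intro k
    simp only [ψ]
    rw [eval₂_T, hT]
  have hψ : ∀ p k, ψ (laurentMonomial p k) = ((w ^ (χ p).toAdd : (LaurentPolynomial (GroundRing P))ˣ)
      : LaurentPolynomial (GroundRing P)) * laurentMonomial p k := by
    intro p k
    rw [laurentMonomial, map_mul, hψC, hψT]
    ring
  refine dvd_of_retraction ψ ?_ ?_ (one_add_laurentMonomial_ne_zero s n) ?_ h
  · rw [map_add, map_one, hψ, hr, toAdd_ofAdd, zpow_one, hw]
  · rw [map_add, map_one, hψ, hs, toAdd_one, zpow_zero, Units.val_one, one_mul]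
  · have hC : ∀ a : GroundRing P, 1 + laurentMonomial r m ∣ C a - ψ (C a) := by
      intro a
      induction a using MonoidAlgebra.induction_on with
      | of p =>
        rw [hψC]
        have := (dvd_zpow_sub_one hw' (χ p).toAdd).mul_left (C (MonoidAlgebra.of ℤ P p))
        rw [← dvd_neg]
        convert this using 1
        ring
      | add a b ha hb => rw [map_add, map_add]; exact dvd_sub_add ha hb
      | smul k a ha =>
        rw [map_zsmul, map_zsmul, ← zsmul_sub]
        exact ha.trans (by rw [zsmul_eq_mul]; exact Dvd.intro_left _ rfl)
    intro c
    induction c using LaurentPolynomial.induction_on' with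
    | add a b ha hb => rw [map_add]; exact dvd_sub_add ha hb
    | C_mul_T k a =>
      rw [map_mul]
      exact dvd_sub_mul (hC a) (by rw [hψT, sub_self]; exact dvd_zero _)

end LaurentMonomial

namespace Seed

variable {P : Type u} [CommGroup P] [IsMulTorsionFree P]
  {F : Type v} [Field F] [Algebra (GroundField P) F] [Algebra (GroundRing P) F]
  [IsScalarTower (GroundRing P) (GroundField P) F]

/-- Evaluation of Laurent polynomials in one variable at the cluster variable `x k`. -/
noncomputable def laurentEval {n : ℕ} (S : Seed P F n) (k : Fin n) :
    LaurentPolynomial (GroundRing P) →+* F :=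
  LaurentPolynomial.eval₂ (algebraMap (GroundRing P) F) (Units.mk0 (S.x k) (S.x_ne_zero k))

lemma laurentEval_monomial {n : ℕ} (S : Seed P F n) (k : Fin n) (p : P) (m : ℤ) :
    S.laurentEval k (laurentMonomial p m) = coeffHom F p * S.x k ^ m := by
  rw [laurentEval, laurentMonomial, LaurentPolynomial.eval₂_C_mul_T]
  simp [coeffHom]

lemma laurentEval_injective {n : ℕ} (S : Seed P F n) (k : Fin n) :
    Function.Injective (S.laurentEval k) := by
  rw [injective_iff_map_eq_zero]
  intro f hf
  obtain ⟨m, g, hg⟩ := LaurentPolynomial.exists_T_pow f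
  have h1 : S.laurentEval k (Polynomial.toLaurent g) = 0 := by rw [hg, map_mul, hf, zero_mul]
  rw [laurentEval, LaurentPolynomial.eval₂_toLaurent, Units.val_mk0,
    IsScalarTower.algebraMap_eq (GroundRing P) (GroundField P) F, ← Polynomial.eval₂_map] at h1
  have h2 := (transcendental_iff.1 (S.isTranscendenceBasis.1.transcendental k)) _ h1
  rw [Polynomial.map_eq_zero_iff (IsFractionRing.injective _ _)] at h2
  rw [h2, map_zero] at hg
  exact (mul_eq_zero.1 hg.symm).resolve_right (LaurentPolynomial.isUnit_T _).ne_zero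

lemma range_laurentEval {n : ℕ} (S : Seed P F n) (k : Fin n) {z : F} :
    z ∈ S.laurent {k} ↔ ∃ f, S.laurentEval k f = z := by
  constructor
  · intro hz
    induction hz using Algebra.adjoin_induction with
    | mem z hz =>
      rcases hz with ⟨i, rfl, rfl⟩ | ⟨i, rfl, rfl⟩
      · exact ⟨laurentMonomial 1 1, by simp [laurentEval_monomial]⟩
      · exact ⟨laurentMonomial 1 (-1), by simp [laurentEval_monomial]⟩
    | algebraMap r => exact ⟨LaurentPolynomial.C r, by simp [laurentEval]⟩
    | add x y _ _ hx hy =>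
      obtain ⟨f, rfl⟩ := hx
      obtain ⟨g, rfl⟩ := hy
      exact ⟨f + g, map_add _ _ _⟩
    | mul x y _ _ hx hy =>
      obtain ⟨f, rfl⟩ := hx
      obtain ⟨g, rfl⟩ := hy
      exact ⟨f * g, map_mul _ _ _⟩
  · rintro ⟨f, rfl⟩
    induction f using LaurentPolynomial.induction_on' with
    | add p q hp hq => rw [map_add]; exact add_mem hp hq
    | C_mul_T m a =>
      rw [laurentEval, LaurentPolynomial.eval₂_C_mul_T]
      refine mul_mem (Subalgebra.algebraMap_mem _ _) ?_
      obtain ⟨l, rfl | rfl⟩ := m.eq_nat_or_neg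
      · simpa using pow_mem (S.x_mem_laurent (Set.mem_singleton k)) l
      · simpa using pow_mem (S.inv_mem_laurent (Set.mem_singleton k)) l

lemma exchangeElement_eq_laurentEval {n : ℕ} (S : Seed P F n) {i k : Fin n}
    (h : ∀ l, l ≠ k → S.B l i = 0) : S.exchangeElement i = S.laurentEval k
      (laurentMonomial (S.pNeg i) (-S.B k i).toNat *
        (1 + laurentMonomial (S.pPos i / S.pNeg i) (S.B k i))) := by
  rw [mul_add, mul_one, laurentMonomial_mul, mul_div_cancel, map_add, laurentEval_monomial,
    laurentEval_monomial, show (((-S.B k i).toNat : ℕ) : ℤ) + S.B k i = ((S.B k i).toNat : ℕ) by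
      omega, zpow_natCast, zpow_natCast, exchangeElement_eq, binomial, add_comm]
  congr 2
  · exact Finset.prod_eq_single k (fun l _ hl => by simp [h l hl]) (by simp)
  · exact Finset.prod_eq_single k (fun l _ hl => by simp [h l hl]) (by simp)

lemma exchangeElement_coprime (S : Seed P F 3) {i j : Fin 3} (hij : i ≠ j) (hB : S.B i j = 0)
    (hB' : S.B j i = 0) {χ : P →* Multiplicative ℤ}
    (hi : χ (S.pPos i / S.pNeg i) = Multiplicative.ofAdd 1) (hj : χ (S.pPos j / S.pNeg j) = 1)
    {a b : F} (ha : a ∈ S.laurent {i, j}ᶜ) (hb : b ∈ S.laurent {i, j}ᶜ)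
    (h : S.exchangeElement i * a = S.exchangeElement j * b) :
    ∃ c ∈ S.laurent {i, j}ᶜ, b = S.exchangeElement i * c := by
  have hd := S.isSignSkewSymmetric.diag
  obtain ⟨k, hk⟩ : ∃ k : Fin 3, ({i, j}ᶜ : Set (Fin 3)) = {k} := by
    obtain ⟨k, hki, hkj⟩ : ∃ k : Fin 3, k ≠ i ∧ k ≠ j := by
      clear hB hB' hi hj ha hb h hd
      revert i j; decide
    refine ⟨k, Set.ext fun l => ?_⟩
    simp only [Set.mem_compl_iff, Set.mem_insert_iff, Set.mem_singleton_iff]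
    omega
  have hl : ∀ l, l ≠ k → l = i ∨ l = j := by
    intro l hlk
    by_contra hl
    have : l ∈ ({i, j}ᶜ : Set (Fin 3)) := hl
    rw [hk] at this
    exact hlk this
  rw [hk] at ha hb ⊢
  obtain ⟨a, rfl⟩ := (S.range_laurentEval k).1 ha
  obtain ⟨b, rfl⟩ := (S.range_laurentEval k).1 hb
  rw [S.exchangeElement_eq_laurentEval (i := i) (k := k) (by
      intro l hlk; rcases hl l hlk with rfl | rfl; exacts [hd _, hB']),
    S.exchangeElement_eq_laurentEval (i := j) (k := k) (by
      intro l hlk; rcases hl l hlk with rfl | rfl; exacts [hB, hd _]), ← map_mul, ← map_mul] at *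
  have h1 := S.laurentEval_injective k h
  obtain ⟨c, hc⟩ := dvd_of_one_add_laurentMonomial_mul hi hj (S.B k i) (S.B k j)
    (a := laurentMonomial (S.pNeg i) (-S.B k i).toNat * a)
    (b := laurentMonomial (S.pNeg j) (-S.B k j).toNat * b) (by linear_combination h1)
  have hu : ∀ (p : P) (m : ℤ), laurentMonomial p m * laurentMonomial p⁻¹ (-m) = 1 := by
    intro p m
    rw [laurentMonomial_mul, mul_inv_cancel, add_neg_cancel, laurentMonomial_one]
  have e1 := hu (S.pNeg i) (-S.B k i).toNat
  have e2 := hu (S.pNeg j) (-S.B k j).toNat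
  refine ⟨_, (S.range_laurentEval k).2 ⟨laurentMonomial (S.pNeg i)⁻¹ (-(-S.B k i).toNat) *
    (laurentMonomial (S.pNeg j)⁻¹ (-(-S.B k j).toNat) * c), rfl⟩, ?_⟩
  rw [← map_mul]
  congr 1
  set u := laurentMonomial (S.pNeg i) (-S.B k i).toNat
  set u' := laurentMonomial (S.pNeg i)⁻¹ (-(-S.B k i).toNat)
  set v := laurentMonomial (S.pNeg j) (-S.B k j).toNat
  set v' := laurentMonomial (S.pNeg j)⁻¹ (-(-S.B k j).toNat)
  set g := laurentMonomial (S.pPos i / S.pNeg i) (S.B k i)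
  linear_combination (-b) * e2 + v' * hc - (1 + g) * v' * c * e1

end Seed

namespace Seed

variable {P : Type u} [CommGroup P] [IsMulTorsionFree P]
  {F : Type v} [Field F] [Algebra (GroundField P) F] [Algebra (GroundRing P) F]
  [IsScalarTower (GroundRing P) (GroundField P) F]

/-- The ratios `p⁺ i / p⁻ i` are independent in the strong sense that there is a dual family of
characters. -/
def HasDualCharacters {n : ℕ} (S : Seed P F n) : Prop :=
  ∃ χ : Fin n → P →* Multiplicative ℤ, ∀ i j,
    χ i (S.pPos j / S.pNeg j) = if i = j then Multiplicative.ofAdd 1 else 1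

/-- The upper bound: the intersection of the rings `bound {i}`. -/
noncomputable def upperBound {n : ℕ} (S : Seed P F n) : Subalgebra (GroundRing P) F :=
  ⨅ i, S.bound {i}

lemma x_mem_upperBound {n : ℕ} (S : Seed P F n) (i : Fin n) : S.x i ∈ S.upperBound :=
  Algebra.mem_iInf.2 fun _ => S.x_mem_bound i

lemma mem_bound_pair {S : Seed P F 3} (hS : S.HasDualCharacters) {f : F}
    (hf : f ∈ S.upperBound) {i j : Fin 3} (hij : i ≠ j) : f ∈ S.bound {i, j} := by
  have hd := S.isSignSkewSymmetric.diag
  have hfi := Algebra.mem_iInf.1 hf i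
  have hfj := Algebra.mem_iInf.1 hf j
  by_cases hB : S.B j i = 0
  · have hB' : S.B i j = 0 := by
      rcases S.isSignSkewSymmetric i j with h | h
      · exact h.1
      · simp [hB] at h
    obtain ⟨χ, hχ⟩ := hS
    exact S.mem_bound_pair_of_coprime hij hB' hB (fun a ha b hb h =>
      S.exchangeElement_coprime hij hB' hB (χ := χ i) (by simp [hχ]) (by simp [hχ, hij]) ha hb h)
      hfi hfj
  · refine S.mem_bound_of_mem_of_mem (i := i) (j := j) ?_ (t₁ := {j}) (t₂ := {i}) ?_ ?_ hfj hfi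
    · rcases lt_or_gt_of_ne hB with h | h
      · refine Or.inr ⟨h, ?_⟩
        rintro l (rfl | rfl)
        exacts [(hd _).le, h.le]
      · refine Or.inl ⟨h, ?_⟩
        rintro l (rfl | rfl)
        exacts [(hd _).ge, h.le]
    · rintro l (rfl | rfl) hl
      exacts [absurd rfl hl, rfl]
    · rintro l (rfl | rfl) hl
      exacts [rfl, absurd rfl hl]

lemma IsMutation.upperBound_le {S S' : Seed P F 3} {k : Fin 3} (h : IsMutation k S S')
    (hS : S.HasDualCharacters) : S.upperBound ≤ S'.upperBound := by
  intro f hf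
  refine Algebra.mem_iInf.2 fun i => ?_
  have key : ∀ l, l ≠ k → f ∈ S'.bound {k, l} := fun l hl => by
    rw [h.bound_eq]; exact mem_bound_pair hS hf hl.symm
  by_cases hi : i = k
  · subst hi
    obtain ⟨l, hl⟩ := exists_ne i
    exact S'.bound_mono (by simp) (key l hl)
  · exact S'.bound_mono (by simp) (key i hi)

/-- An acyclic quiver on three vertices with at least one arrow has a source or sink which is not
isolated. -/
lemma _root_.ClusterAlgebra.IsAcyclicMatrix.exists_column {B : Matrix (Fin 3) (Fin 3) ℤ}
    (hB : IsAcyclicMatrix B) (hs : IsSignSkewSymmetric B) (h0 : B ≠ 0) :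
    ∃ i j, 0 < B j i ∧ ∀ l, 0 ≤ B l i := by
  obtain ⟨a, b, hab⟩ : ∃ a b, 0 < B a b := by
    by_contra! h
    apply h0
    ext a b
    refine le_antisymm (h a b) (not_lt.1 fun h' => ?_)
    exact absurd (h b a) (not_le.2 ((hs.neg_iff _ _).2 h'))
  have hne : a ≠ b := by rintro rfl; exact hab.ne' (hs.diag a)
  obtain ⟨c, hc⟩ : ∃ c : Fin 3, ∀ l, l = a ∨ l = b ∨ l = c := by
    clear hab
    revert a b
    decide
  by_cases hcb : 0 ≤ B c b
  · refine ⟨b, a, hab, fun l => ?_⟩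
    rcases hc l with rfl | rfl | rfl
    exacts [hab.le, (hs.diag _).ge, hcb]
  · have hbc : 0 < B b c := (hs.neg_iff _ _).2 (not_le.1 hcb)
    refine ⟨c, b, hbc, fun l => ?_⟩
    rcases hc l with rfl | rfl | rfl
    · by_contra h
      have hca : 0 < B c l := (hs.neg_iff _ _).2 (not_le.1 h)
      exact hB l (.tail (.tail (.single hab) hbc) hca)
    · exact hbc.le
    · exact (hs.diag _).ge

lemma upperBound_le_of_isAcyclic {S : Seed P F 3} (hS : S.HasDualCharacters) (ha : S.IsAcyclic)
    (h0 : S.B ≠ 0) : S.upperBound ≤ S.bound Set.univ := by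
  intro f hf
  obtain ⟨i, j, hj, hi⟩ := ha.exists_column S.isSignSkewSymmetric h0
  have key : ∀ a : Fin 3, f ∈ S.bound {a}ᶜ := by
    intro a
    obtain ⟨b, c, hbc, h⟩ : ∃ b c : Fin 3, b ≠ c ∧ ∀ l, l ≠ a → l = b ∨ l = c := by
      clear hi hj
      revert a; decide
    exact S.bound_mono (fun l hl => h l hl) (mem_bound_pair hS hf hbc)
  exact S.mem_bound_of_mem_of_mem (Or.inl ⟨hj, fun l _ => hi l⟩) (fun l _ hl => hl)
    (fun l _ hl => hl) (key i) (key j)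

lemma MutationEquivalent.x_mem_bound_of_eq_zero {n : ℕ} {S T : Seed P F n}
    (h : S.MutationEquivalent T) (h0 : S.B = 0) (i : Fin n) : T.x i ∈ S.bound Set.univ := by
  suffices T.B = 0 ∧ ∀ i, T.x i ∈ S.bound Set.univ ∧ T.x' i ∈ S.bound Set.univ from (this.2 i).1
  refine h.induction (motive := fun T => T.B = 0 ∧ ∀ i, T.x i ∈ S.bound Set.univ ∧
    T.x' i ∈ S.bound Set.univ) ⟨h0, fun i => ⟨S.x_mem_bound i, S.x'_mem_bound i⟩⟩ ?_
  rintro T T' k - hm ⟨hB, hT⟩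
  have hB' : T'.B = 0 := by
    rw [hm.matrix_eq, hB]
    ext i j
    simp [matrixMutation]
  refine ⟨hB', fun i => ?_⟩
  by_cases hi : i = k
  · subst hi
    rw [hm.x_self, hm.x'_self]
    exact ⟨(hT i).2, (hT i).1⟩
  refine ⟨hm.x_of_ne i hi ▸ (hT i).1, ?_⟩
  have hr := hm.ratio_of_nonneg i hi (by simp [hB])
  rw [hB, Matrix.zero_apply, zpow_zero, one_mul] at hr
  obtain ⟨u, hu⟩ : ∃ u, T'.pNeg i = u * T.pNeg i := ⟨T'.pNeg i / T.pNeg i, by simp⟩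
  have hu' : T'.pPos i = u * T.pPos i := by
    rw [div_eq_iff_eq_mul, hu] at hr
    rw [hr, mul_left_comm, div_mul_cancel]
  have : T'.x' i = coeffHom F u * T.x' i := by
    rw [x', x', hm.x_of_ne i hi, ← mul_div_assoc, exchangeElement_eq, exchangeElement_eq, hB, hB',
      hu, hu']
    simp [binomial, mul_add]
  rw [this]
  exact mul_mem (coeffHom_mem _ _) (hT i).2

/-- If all cluster variables lie in the lower bound of an acyclic seed, then the lower bound is the
cluster algebra. -/
lemma clusterAlgebra_eq_bound {n : ℕ} {S : Seed P F n} (hS : IsSkewSymmetrizable S.B)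
    (h : ∀ T, S.MutationEquivalent T → ∀ i, T.x i ∈ S.bound Set.univ) :
    S.clusterAlgebra = S.bound Set.univ := by
  refine le_antisymm (Algebra.adjoin_le ?_) (S.bound_le (fun i => ?_) (fun i _ => ?_) ?_)
  · rintro _ ⟨T, hT, i, rfl⟩
    exact h T hT i
  · exact Algebra.subset_adjoin ⟨S, Relation.EqvGen.refl _, i, rfl⟩
  · obtain ⟨S', hS'⟩ := S.exists_isMutation_of_isSkewSymmetrizable i hS
    exact Algebra.subset_adjoin ⟨S', hS'.mutationEquivalent, i, hS'.x_self⟩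
  · intro i hi
    exact absurd (Set.mem_univ i) hi

lemma fg_bound_univ {n : ℕ} (S : Seed P F n) : (S.bound Set.univ).FG :=
  Subalgebra.fg_def.2 ⟨_, ((Set.finite_range _).union (Set.toFinite _)).union (Set.toFinite _), rfl⟩

end Seed

namespace Seed

section Lift

variable {P : Type*} [CommGroup P] [IsMulTorsionFree P]
  {F : Type*} [Field F] [Algebra (GroundField P) F] [Algebra (GroundRing P) F]
  [IsScalarTower (GroundRing P) (GroundField P) F]
  {Q : Type*} [CommGroup Q] [IsMulTorsionFree Q]
  {G : Type*} [Field G] [Algebra (GroundField Q) G] [Algebra (GroundRing Q) G]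
  [IsScalarTower (GroundRing Q) (GroundField Q) G]
  {A : Type*} [CommRing A] {n : ℕ}

/-- The seed `T` over `P` is the specialization of the seed `U` over `Q`, along `θ` on coefficients
and along `α`, `β` on cluster variables, where `U` has independent coefficients. -/
structure IsSpecialization (α : A →+* G) (β : A →+* F) (θ : Q →* P) (σ : P →* Q)
    (U : Seed Q G n) (T : Seed P F n) : Prop where
  B_eq : U.B = T.B
  pPos_eq : ∀ i, θ (U.pPos i) = T.pPos i
  pNeg_eq : ∀ i, θ (U.pNeg i) = T.pNeg i
  x_rel : ∀ i, PartialMap α β (U.x i) (T.x i)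
  exists_character : ∃ (χ : Fin n → Q →* Multiplicative ℤ) (ε : Fin n → ℤ),
    (∀ j p, χ j (σ p) = 1) ∧
    (∀ j i, χ j (U.pPos i) = if j = i then Multiplicative.ofAdd (ε i) else 1) ∧
    ∀ j i, χ j (U.pNeg i) = if j = i then Multiplicative.ofAdd (ε i - 1) else 1

variable {α : A →+* G} {β : A →+* F} {θ : Q →* P} {σ : P →* Q} {U : Seed Q G n} {T T' : Seed P F n}

lemma IsSpecialization.hasDualCharacters (h : IsSpecialization α β θ σ U T) :
    U.HasDualCharacters := by
  obtain ⟨χ, ε, -, h1, h2⟩ := h.exists_character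
  refine ⟨χ, fun i j => ?_⟩
  rw [map_div, h1, h2]
  split_ifs
  · rw [← ofAdd_sub]; congr 1; ring
  · simp

lemma IsSpecialization.x'_rel (hker : ∀ a, α a = 0 → β a = 0)
    (hθ : ∀ q, PartialMap α β (coeffHom G q) (coeffHom F (θ q)))
    (h : IsSpecialization α β θ σ U T) (i : Fin n) : PartialMap α β (U.x' i) (T.x' i) := by
  refine PartialMap.div hker ?_ (h.x_rel i) (T.x_ne_zero i)
  rw [exchangeElement_eq, exchangeElement_eq, h.B_eq, ← h.pPos_eq, ← h.pNeg_eq]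
  exact PartialMap.binomial (hθ _) (hθ _) h.x_rel _

/-- The ratio of the coefficients in direction `i` after mutation in direction `k`. -/
def mutatedRatio (U : Seed Q G n) (k i : Fin n) : Q :=
  (if 0 ≤ U.B k i then U.pPos k else U.pNeg k) ^ U.B k i * (U.pPos i / U.pNeg i)

/-- Mutations of a specialization lift. -/
lemma IsSpecialization.exists_isMutation (hker : ∀ a, α a = 0 → β a = 0)
    (hθ : ∀ q, PartialMap α β (coeffHom G q) (coeffHom F (θ q))) (hσ : ∀ p, θ (σ p) = p)
    (h : IsSpecialization α β θ σ U T) {k : Fin n} (hm : IsMutation k T T') :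
    ∃ U', IsMutation k U U' ∧ IsSpecialization α β θ σ U' T' := by
  have hB : IsSignSkewSymmetric (matrixMutation k U.B) := by
    rw [h.B_eq, ← hm.matrix_eq]; exact T'.isSignSkewSymmetric
  have hr : ∀ i, i ≠ k → θ (U.mutatedRatio k i) = T'.pPos i / T'.pNeg i := by
    intro i hi
    rw [mutatedRatio, h.B_eq]
    split_ifs with hb
    · rw [hm.ratio_of_nonneg i hi hb]
      simp [h.pPos_eq, h.pNeg_eq]
    · rw [hm.ratio_of_nonpos i hi (not_le.1 hb).le]
      simp [h.pPos_eq, h.pNeg_eq]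
  refine ⟨U.mutate k (fun i => σ (T'.pNeg i) * U.mutatedRatio k i) (fun i => σ (T'.pNeg i)) hB,
    isMutation_mutate _ _ _ _ _ ?_ ?_, ?_, ?_, ?_, ?_, ?_⟩
  · intro i _ hb
    simp [mutatedRatio, hb]
  · intro i _ hb
    rcases hb.lt_or_eq with hb | hb
    · simp [mutatedRatio, hb.not_ge]
    · simp [mutatedRatio, hb]
  · rw [hm.matrix_eq, ← h.B_eq]; rfl
  · intro i
    by_cases hi : i = k
    · subst hi
      simp [mutate, hm.pPos_self, h.pNeg_eq]
    · simp [mutate, hi, hσ, hr i hi]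
  · intro i
    by_cases hi : i = k
    · subst hi
      simp [mutate, hm.pNeg_self, h.pPos_eq]
    · simp [mutate, hi, hσ]
  · intro i
    by_cases hi : i = k
    · subst hi
      simpa [mutate, hm.x_self] using h.x'_rel hker hθ i
    · simpa [mutate, hi, hm.x_of_ne] using h.x_rel i
  · obtain ⟨χ, ε, h0, h1, h2⟩ := h.exists_character
    let c : Fin n → ℤ := fun i => if i = k then 0 else
      if 0 ≤ U.B k i then U.B k i * ε k else U.B k i * (ε k - 1)
    let χ' : Fin n → Q →* Multiplicative ℤ := Function.update χ k ((χ k)⁻¹ * ∏ i, χ i ^ c i)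
    have hχ' : ∀ j, j ≠ k → χ' j = χ j := fun j hj => Function.update_of_ne hj _ _
    have hχk : ∀ q, χ' k q = (χ k q)⁻¹ * ∏ i, χ i q ^ c i := by
      intro q
      simp only [χ', Function.update_self, MonoidHom.mul_apply, MonoidHom.inv_apply,
        MonoidHom.finsetProd_apply]
      rfl
    have hck : c k = 0 := if_pos rfl
    have hone : ∀ q, (∀ j, j ≠ k → χ j q = 1) → χ' k q = (χ k q)⁻¹ := by
      intro q hq
      rw [hχk, Finset.prod_eq_one, mul_one]
      intro i _
      by_cases hi : i = k
      · rw [hi, hck, zpow_zero]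
      · rw [hq i hi, one_zpow]
    have hk1 : χ' k (U.pPos k) = Multiplicative.ofAdd (-ε k) := by
      rw [hone _ fun j hj => by rw [h1, if_neg hj], h1, if_pos rfl, ofAdd_neg]
    have hk2 : χ' k (U.pNeg k) = Multiplicative.ofAdd (1 - ε k) := by
      rw [hone _ fun j hj => by rw [h2, if_neg hj], h2, if_pos rfl, ← ofAdd_neg, neg_sub]
    have hσ' : ∀ j p, χ' j (σ p) = 1 := by
      intro j p
      by_cases hj : j = k
      · subst hj
        rw [hone _ fun i _ => h0 i p, h0, inv_one]
      · rw [hχ' j hj, h0]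
    have hratio : ∀ j i, χ j (U.pPos i / U.pNeg i) =
        if j = i then Multiplicative.ofAdd 1 else 1 := by
      intro j i
      rw [map_div, h1, h2]
      split_ifs
      · rw [← ofAdd_sub]; congr 1; ring
      · simp
    have hmut : ∀ j i, i ≠ k → χ' j (U.mutatedRatio k i) =
        if j = i then Multiplicative.ofAdd 1 else 1 := by
      intro j i hi
      rw [mutatedRatio, map_mul, map_zpow]
      by_cases hj : j = k
      · subst hj
        rw [if_neg (Ne.symm hi), hχk (U.pPos i / U.pNeg i), hratio, if_neg (Ne.symm hi), inv_one,
          one_mul, Finset.prod_eq_single i (fun l _ hl => by rw [hratio, if_neg hl, one_zpow])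
            (by simp), hratio, if_pos rfl]
        simp only [c, if_neg hi]
        split_ifs
        · rw [hk1, ← ofAdd_zsmul, ← ofAdd_zsmul, ← ofAdd_add, ← ofAdd_zero]
          congr 1
          simp
        · rw [hk2, ← ofAdd_zsmul, ← ofAdd_zsmul, ← ofAdd_add, ← ofAdd_zero]
          congr 1
          simp only [smul_eq_mul]
          ring
      · rw [hχ' j hj, hratio]
        split_ifs <;> simp [h1, h2, hj]
    refine ⟨χ', fun i => if i = k then 1 - ε k else 1, hσ', ?_, ?_⟩
    · intro j i
      by_cases hi : i = k
      · subst hi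
        simp only [mutate, Function.update_self, if_true]
        by_cases hj : j = i
        · subst hj; rw [hk2, if_pos rfl]
        · rw [hχ' j hj, h2, if_neg hj, if_neg hj]
      · simp only [mutate, Function.update_of_ne hi, if_neg hi]
        rw [map_mul, hσ', one_mul, hmut j i hi]
    · intro j i
      by_cases hi : i = k
      · subst hi
        simp only [mutate, Function.update_self, if_true]
        by_cases hj : j = i
        · subst hj; rw [hk1, if_pos rfl]; congr 1; ring
        · rw [hχ' j hj, h1, if_neg hj, if_neg hj]
      · simp only [mutate, Function.update_of_ne hi, if_neg hi]
        rw [hσ', sub_self]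
        simp

/-- All cluster variables of seeds mutation equivalent to an acyclic seed of rank three which is a
specialization of a seed with independent coefficients lie in its lower bound. -/
lemma IsSpecialization.x_mem_bound {U : Seed Q G 3} {S T : Seed P F 3}
    (hker : ∀ a, α a = 0 → β a = 0) (θR : GroundRing Q →+* GroundRing P)
    (hθR : ∀ q, θR (MonoidAlgebra.of ℤ Q q) = MonoidAlgebra.of ℤ P (θ q))
    (hθ : ∀ r, PartialMap α β (algebraMap (GroundRing Q) G r) (algebraMap (GroundRing P) F (θR r)))
    (hσ : ∀ p, θ (σ p) = p) (h : IsSpecialization α β θ σ U S) (hS : S.IsAcyclic)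
    (h0 : S.B ≠ 0) (hT : S.MutationEquivalent T) (i : Fin 3) : T.x i ∈ S.bound Set.univ := by
  have hθ' : ∀ q, PartialMap α β (coeffHom G q) (coeffHom F (θ q)) := by
    intro q
    have := hθ (MonoidAlgebra.of ℤ Q q)
    rwa [hθR] at this
  obtain ⟨V, hV, hVU⟩ : ∃ V, IsSpecialization α β θ σ V T ∧ V.upperBound ≤ U.upperBound := by
    refine hT.induction (motive := fun T => ∃ V, IsSpecialization α β θ σ V T ∧
      V.upperBound ≤ U.upperBound) ⟨U, h, le_rfl⟩ ?_
    rintro T T' k - hm ⟨V, hV, hVU⟩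
    obtain ⟨V', hm', hV'⟩ := hV.exists_isMutation hker hθ' hσ hm
    exact ⟨V', hV', (hm'.symm.upperBound_le hV'.hasDualCharacters).trans hVU⟩
  have hmem : V.x i ∈ U.bound Set.univ :=
    upperBound_le_of_isAcyclic h.hasDualCharacters (by rw [IsAcyclic, h.B_eq]; exact hS)
      (by rwa [h.B_eq]) (hVU (V.x_mem_upperBound i))
  obtain ⟨w, hw, hwx⟩ := PartialMap.exists_of_mem_adjoin (α := α) (β := β)
    (W := (S.bound Set.univ).toSubring) (fun r => ⟨_, Subalgebra.algebraMap_mem _ _, hθ r⟩) (by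
      rintro _ ((⟨j, rfl⟩ | ⟨j, -, rfl⟩) | ⟨j, hj, rfl⟩)
      · exact ⟨_, S.x_mem_bound j, h.x_rel j⟩
      · exact ⟨_, S.x'_mem_bound j, h.x'_rel hker hθ' j⟩
      · exact absurd (Set.mem_univ j) hj) hmem
  rw [PartialMap.unique hker (hV.x_rel i) hwx]
  exact hw

end Lift

section Generic

variable {P : Type u} [CommGroup P] [IsMulTorsionFree P]
  {F : Type v} [Field F] [Algebra (GroundField P) F] [Algebra (GroundRing P) F]
  [IsScalarTower (GroundRing P) (GroundField P) F]

/-- The coefficient group `P` with an independent parameter adjoined for each direction. -/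
abbrev GenericCoeff (P : Type u) (n : ℕ) : Type u := P × (Fin n → Multiplicative ℤ)

/-- The field of rational functions over the field of fractions of `ℤP`. -/
abbrev RationalFunctionField (P : Type u) [CommGroup P] [IsMulTorsionFree P] (n : ℕ) : Type u :=
  FractionRing (MvPolynomial (Fin n) (GroundField P))

variable {n : ℕ}

/-- The seed with the same exchange matrix as `S` and independent coefficients. -/
noncomputable def generic (S : Seed P F n) :
    Seed (GenericCoeff P n) (RationalFunctionField (GenericCoeff P n) n) n where
  x := algebraMap (MvPolynomial (Fin n) (GroundField (GenericCoeff P n))) _ ∘ MvPolynomial.X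
  isTranscendenceBasis :=
    have : Algebra.IsAlgebraic (MvPolynomial (Fin n) (GroundField (GenericCoeff P n)))
        (RationalFunctionField (GenericCoeff P n) n) :=
      IsLocalization.isAlgebraic _ (nonZeroDivisors _)
    (IsTranscendenceBasis.mvPolynomial _ _).algebraMap_comp
  pPos i := (S.pPos i, Pi.mulSingle i (Multiplicative.ofAdd 1))
  pNeg i := (S.pNeg i, 1)
  B := S.B
  isSignSkewSymmetric := S.isSignSkewSymmetric

/-- The inclusion of polynomials over `ℤP` in rational functions. -/
noncomputable def polynomialInclusion (P : Type u) [CommGroup P] [IsMulTorsionFree P] (n : ℕ) :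
    MvPolynomial (Fin n) (GroundRing P) →+* RationalFunctionField P n :=
  (algebraMap (MvPolynomial (Fin n) (GroundField P)) _).comp
    (MvPolynomial.map (algebraMap (GroundRing P) (GroundField P)))

lemma polynomialInclusion_injective : Function.Injective (polynomialInclusion P n) := by
  rw [polynomialInclusion, RingHom.coe_comp]
  exact (IsFractionRing.injective _ _).comp
    (MvPolynomial.map_injective _ (IsFractionRing.injective _ _))

lemma polynomialInclusion_C (r : GroundRing P) :
    polynomialInclusion P n (MvPolynomial.C r) = algebraMap _ _ r := by
  rw [polynomialInclusion, RingHom.comp_apply, MvPolynomial.map_C, ← MvPolynomial.algebraMap_eq,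
    ← IsScalarTower.algebraMap_apply, ← IsScalarTower.algebraMap_apply]

/-- The specialization of polynomials at the cluster of `S`. -/
noncomputable def specialize (S : Seed P F n) :
    MvPolynomial (Fin n) (GroundRing (GenericCoeff P n)) →+* F :=
  MvPolynomial.eval₂Hom ((algebraMap (GroundRing P) F).comp
    (MonoidAlgebra.mapDomainRingHom ℤ (MonoidHom.fst P (Fin n → Multiplicative ℤ)))) S.x

lemma generic_isSpecialization (S : Seed P F n) :
    IsSpecialization (polynomialInclusion (GenericCoeff P n) n) S.specialize (MonoidHom.fst P _)
      (MonoidHom.inl P _) S.generic S where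
  B_eq := rfl
  pPos_eq _ := rfl
  pNeg_eq _ := rfl
  x_rel i := by
    have := PartialMap.of (α := polynomialInclusion (GenericCoeff P n) n) (β := S.specialize)
      (MvPolynomial.X i)
    simpa [polynomialInclusion, specialize, generic] using this
  exists_character := by
    refine ⟨fun j => (Pi.evalMonoidHom _ j).comp (MonoidHom.snd P _), fun _ => 1, ?_, ?_, ?_⟩
    · intro j p
      rfl
    · intro j i
      simp [generic, Pi.mulSingle_apply]
    · intro j i
      simp [generic]

end Generic

variable {P : Type u} [CommGroup P] [IsMulTorsionFree P]
  {F : Type v} [Field F] [Algebra (GroundField P) F] [Algebra (GroundRing P) F]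
  [IsScalarTower (GroundRing P) (GroundField P) F]

lemma MutationEquivalent.x_mem_bound {S T : Seed P F 3} (h : S.MutationEquivalent T)
    (hS : S.IsAcyclic) (i : Fin 3) : T.x i ∈ S.bound Set.univ := by
  by_cases h0 : S.B = 0
  · exact h.x_mem_bound_of_eq_zero h0 i
  refine S.generic_isSpecialization.x_mem_bound
    (fun a ha => by
      rw [(injective_iff_map_eq_zero _).1 polynomialInclusion_injective a ha, map_zero])
    (MonoidAlgebra.mapDomainRingHom ℤ (MonoidHom.fst P (Fin 3 → Multiplicative ℤ)))
    (fun q => by simp) (fun r => ?_) (fun p => rfl) hS h0 h i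
  have := PartialMap.of (α := polynomialInclusion (GenericCoeff P 3) 3) (β := S.specialize)
    (MvPolynomial.C r)
  rwa [polynomialInclusion_C, specialize, MvPolynomial.eval₂Hom_C] at this

lemma fg_of_isAcyclic {S T : Seed P F 3} (hS : IsSkewSymmetrizable S.B)
    (h : S.MutationEquivalent T) (hT : T.IsAcyclic) : S.clusterAlgebra.FG := by
  rw [clusterAlgebra_eq_of_mutationEquivalent h,
    clusterAlgebra_eq_bound (h.isSkewSymmetrizable hS) fun U hU => hU.x_mem_bound hT]
  exact T.fg_bound_univ

end Seed

end ClusterAlgebra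

theorem theorem1p24 {P : Type*} [CommGroup P] [IsMulTorsionFree P]
    {F : Type*} [Field F] [Algebra (ClusterAlgebra.GroundField P) F]
    [Algebra (ClusterAlgebra.GroundRing P) F]
    [IsScalarTower (ClusterAlgebra.GroundRing P) (ClusterAlgebra.GroundField P) F]
    (hF : Nonempty (F ≃ₐ[ClusterAlgebra.GroundField P]
      FractionRing (MvPolynomial (Fin 3) (ClusterAlgebra.GroundField P))))
    (S : ClusterAlgebra.Seed P F 3)
    (hS : ClusterAlgebra.IsSkewSymmetrizable S.B) :
    S.clusterAlgebra.FG ↔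
      ∃ S' : ClusterAlgebra.Seed P F 3, S.MutationEquivalent S' ∧ S'.IsAcyclic :=
  ⟨ClusterAlgebra.Seed.exists_isAcyclic_of_fg hS,
    fun ⟨_, h, h'⟩ => ClusterAlgebra.Seed.fg_of_isAcyclic hS h h'⟩
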